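/- Let $q,r\ge 2$. Let $\mathbb T_q$ be the homogeneous tree of degree $q+1$ with a fixed reference end $\omega$ and Busemann function $\mathfrak h:\mathbb T_q\to\mathbb Z$: each vertex $x$ has one neighbour $x^-$ (its predecessor) with $\mathfrak h(x^-)=\mathfrak h(x)-1$, the next vertex on the geodesic ray from $x$ to $\omega$, and $q$ neighbours (its successors) with $\mathfrak h=\mathfrak h(x)+1$. The edges from $x$ to its successors are labelled $0,\dots,q-1$, in such a way that along each ray to $\omega$ all but finitely many labels are $0$. Thus $\mathbb T_q$ is identified with $\Sigma_q\times\mathbb Z$, where $\Sigma_q$ is the set of finitely supported sequences with values in $\mathbb Z_q$, and $x\in\mathbb T_q$ corresponds to the sequence of labels along its ray to $\omega$ together with $\mathfrak h(x)$. Write $z\preccurlyeq v$ if $z$ lies on the geodesic ray from $v$ to $\omega$. The same is done for $\mathbb T_r$. The Diestel–Leader graph $DL=DL(q,r)$ has vertex set $\{x_1x_2\in\mathbb T_q\times\mathbb T_r:\mathfrak h(x_1)+\mathfrak h(x_2)=0\}$, with $x_1x_2\sim y_1y_2$ if and only if $x_1\sim y_1$ and $x_2\sim y_2$; it is regular of degree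 $q+r$. Let $Pf(x)=\frac1{q+r}\sum_{y\sim x}f(y)$ be the transition operator of simple random walk, acting on the complex Hilbert space $\ell^2(DL)$. Put $\rho=\frac{2\sqrt{qr}}{q+r}$ and $\lambda_{m,n}=\rho\cos\frac{m\pi}{n}$. A tetrahedron of height $n=n(S)\ge0$ is a set $S=S(a_1,a_2)=\{x_1x_2\in DL: a_1\preccurlyeq x_1,\ a_2\preccurlyeq x_2\}$, where $a_1\in\mathbb T_q$, $a_2\in\mathbb T_r$ and $-\mathfrak h(a_2)=\mathfrak h(a_1)+n$. For $1\le i\le q-1$ let $\varphi^1_i:\mathbb Z_q=\{0,\dots,q-1\}\to\mathbb R$ be given by $$\varphi^1_i(s)=\begin{cases}\dfrac{q-i}{\sqrt{(q-i)(q+1-i)}},& s=i-1,\\[2mm] -\dfrac{1}{\sqrt{(q-i)(q+1-i)}},& i\le s\le q-1,\\[2mm] 0,&\text{otherwise,}\end{cases}$$ and define $\varphi^2_j:\mathbb Z_r\to\mathbb R$, $1\le j\le r-1$, in the same way with $r,j$ in place of $q,i$. Let $f^{1}_0\equiv0$, and for $k\ge1$ let $f^{1}_k(x_1)=\varphi^1_i(s)\,q^{(1-k)/2}$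 if $\mathfrak h(x_1)=\mathfrak h(a_1)+k$ and $v\preccurlyeq x_1$, where $v$ is the successor of $a_1$ along the edge with label $s$, and $f^1_k(x_1)=0$ otherwise. Define $f^2_k$ on $\mathbb T_r$ in the same way from $a_2$, $\varphi^2_j$ and $r$. For $1\le m\le n-1$ put $$g_m^{[S,i,j]}(x_1x_2)=\sum_{k=1}^{n-1}\sqrt{\tfrac2n}\,\sin\!\Bigl(\frac{km\pi}{n}\Bigr)f^1_k(x_1)\,f^2_{n-k}(x_2)$$ for $x_1x_2\in S$, and $g_m^{[S,i,j]}=0$ off $S$. **Theorem.** (a) The spectrum of $P$ on $\ell^2(DL)$ is the interval $[-\rho,\rho]$, and $\rho$ is the spectral radius of $P$. (b) It is a pure point spectrum: the eigenvectors of $P$ span a dense subspace of $\ell^2(DL)$, the set of eigenvalues of $P$ is $\{\lambda_{m,n}: n\ge2,\ 1\le m\le n-1\}$, and the spectrum of $P$ is the closure of this set. (c) The functions $g_m^{[S,i,j]}$, where $S$ runs through all tetrahedra in $DL$ with height $n(S)\ge 2$, $m\in\{1,\dots,n(S)-1\}$, $i\in\{1,\dots,q-1\}$ and $j\in\{1,\dots,r-1\}$,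 are finitely supported and form a complete orthonormal system in $\ell^2(DL)$, and $$P g_m^{[S,i,j]}=\lambda_{m,n}\,g_m^{[S,i,j]},\qquad n=n(S).$$ -/

import Mathlib

/-! The homogeneous tree of degree `q + 1` with its labelled edges and its reference end. -/

/-- The vertices of the homogeneous tree of degree `q + 1`, in horocyclic coordinates: a vertex is
its level `hor ∈ ℤ` (the value of the Busemann function of the reference end `ω`) together with
the finitely supported sequence of labels in `ℤ_q` along the geodesic ray that runs from the vertex
to `ω`; `label 0` is the label of the edge to the predecessor, `label 1` the next one, and
so on. -/
@[ext] structure HTree (q : ℕ) where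
  label : ℕ → ZMod q
  finite_label : ∃ N, ∀ n, N ≤ n → label n = 0
  hor : ℤ

namespace HTree

variable {q : ℕ}

/-- The predecessor `x⁻`, the neighbour of `x` in direction of the reference end. -/
def pred (x : HTree q) : HTree q where
  label n := x.label (n + 1)
  finite_label := by
    obtain ⟨N, hN⟩ := x.finite_label
    exact ⟨N, fun n hn => hN _ (by omega)⟩
  hor := x.hor - 1

/-- The successor of `x` along the downward edge with label `s`. -/
def succ (x : HTree q) (s : ZMod q) : HTree q where
  label n := Nat.casesOn n s x.label
  finite_label := by
    obtain ⟨N, hN⟩ := x.finite_label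
    refine ⟨N + 1, fun n hn => ?_⟩
    obtain ⟨m, rfl⟩ : ∃ m, n = m + 1 := ⟨n - 1, by omega⟩
    exact hN m (by omega)
  hor := x.hor + 1

/-- The root `o`. -/
def root (q : ℕ) : HTree q := ⟨fun _ => 0, ⟨0, fun _ _ => rfl⟩, 0⟩

@[simp] theorem hor_pred (x : HTree q) : x.pred.hor = x.hor - 1 := rfl

@[simp] theorem hor_succ (x : HTree q) (s : ZMod q) : (x.succ s).hor = x.hor + 1 := rfl

@[simp] theorem pred_succ (x : HTree q) (s : ZMod q) : (x.succ s).pred = x := by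
  ext <;> simp [succ, pred]

theorem succ_pred (x : HTree q) : x.pred.succ (x.label 0) = x := by
  refine HTree.ext (funext fun n => ?_) (by simp)
  cases n <;> rfl

theorem succ_inj {x : HTree q} {s t : ZMod q} (h : x.succ s = x.succ t) : s = t :=
  congrArg (fun y : HTree q => y.label 0) h

theorem eq_pred_iff {x y : HTree q} : x = y.pred ↔ ∃ s, y = x.succ s := by
  constructor
  · rintro rfl
    exact ⟨_, y.succ_pred.symm⟩
  · rintro ⟨s, rfl⟩
    simp

/-- The tree as a graph: the edges join each vertex to its predecessor. -/
def graph (q : ℕ) : SimpleGraph (HTree q) where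
  Adj x y := x = y.pred ∨ y = x.pred
  symm := ⟨fun _ _ h => h.symm⟩
  loopless := ⟨fun x h => by
    have h' : x = x.pred := h.elim id id
    have := congrArg HTree.hor h'
    rw [hor_pred] at this
    omega⟩

/-- The order of the tree with respect to the reference end `ω`: `z ≼ v` if `z` lies on the
geodesic ray `v, v⁻, v⁻⁻, …` from `v` to `ω`. -/
def Above (z v : HTree q) : Prop := ∃ k : ℕ, pred^[k] v = z

theorem hor_iterate_pred (k : ℕ) (x : HTree q) : (pred^[k] x).hor = x.hor - k := by
  induction k with
  | zero => simp
  | succ k ih => rw [Function.iterate_succ_apply', hor_pred, ih]; push_cast; ring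

theorem label_iterate_pred (k : ℕ) (x : HTree q) (n : ℕ) :
    (pred^[k] x).label n = x.label (n + k) := by
  induction k generalizing n with
  | zero => simp
  | succ k ih =>
    rw [Function.iterate_succ_apply']
    change (pred^[k] x).label (n + 1) = _
    rw [ih]
    congr 1
    omega

/-- The rays of iterated predecessors from any two vertices merge: they all represent the same
end `ω`. -/
theorem exists_common (x y : HTree q) : ∃ k l : ℕ, pred^[k] x = pred^[l] y := by
  obtain ⟨N, hN⟩ := x.finite_label
  obtain ⟨M, hM⟩ := y.finite_label
  refine ⟨N + M + (x.hor - y.hor).toNat, N + M + (y.hor - x.hor).toNat,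
    HTree.ext (funext fun n => ?_) ?_⟩
  · rw [label_iterate_pred, label_iterate_pred, hN _ (by omega), hM _ (by omega)]
  · rw [hor_iterate_pred, hor_iterate_pred]
    omega

theorem reachable_iterate (x : HTree q) (k : ℕ) : (graph q).Reachable x (pred^[k] x) := by
  induction k with
  | zero => exact SimpleGraph.Reachable.refl _
  | succ k ih =>
    rw [Function.iterate_succ_apply']
    exact ih.trans (SimpleGraph.Adj.reachable (Or.inr rfl))

theorem connected (q : ℕ) : (graph q).Connected := by
  have : Nonempty (HTree q) := ⟨root q⟩
  refine ⟨fun x y => ?_⟩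
  obtain ⟨k, l, h⟩ := exists_common x y
  exact (reachable_iterate x k).trans (h ▸ (reachable_iterate y l).symm)

theorem acyclic (q : ℕ) : (graph q).IsAcyclic := by
  have key : ∀ x : HTree q, ¬ ((graph q).deleteEdges {s(x, x.pred)}).Reachable x x.pred := by
    intro x hr
    have inv : ∀ y z : HTree q, ((graph q).deleteEdges {s(x, x.pred)}).Adj y z →
        Above x y → Above x z := by
      rintro y z h ⟨k, hk⟩
      rw [SimpleGraph.deleteEdges_adj] at h
      obtain ⟨h | h, hne⟩ := h
      · exact ⟨k + 1, by rw [Function.iterate_succ_apply, ← h, hk]⟩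
      · cases k with
        | zero =>
          simp only [Function.iterate_zero, id] at hk
          subst hk
          exact absurd (by rw [h]; rfl) hne
        | succ k => exact ⟨k, by rw [h, ← Function.iterate_succ_apply, hk]⟩
    have walk : ∀ y z : HTree q, ((graph q).deleteEdges {s(x, x.pred)}).Walk y z →
        Above x y → Above x z := by
      intro y z p
      induction p with
      | nil => exact id
      | cons h _ ih => exact fun hy => ih (inv _ _ h hy)
    obtain ⟨p⟩ := hr
    obtain ⟨k, hk⟩ := walk _ _ p ⟨0, rfl⟩
    have := congrArg HTree.hor hk
    rw [hor_iterate_pred, hor_pred] at this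
    omega
  rw [SimpleGraph.isAcyclic_iff_forall_adj_isBridge]
  rintro v w (rfl | rfl)
  · rw [Sym2.eq_swap, SimpleGraph.isBridge_iff]
    exact key w
  · rw [SimpleGraph.isBridge_iff]
    exact key v

theorem isTree (q : ℕ) : (graph q).IsTree := ⟨connected q, acyclic q⟩

/-- `pred` and the labels parametrize the neighbours: one predecessor and `q` successors. -/
noncomputable def nbrEquiv (x : HTree q) : Option (ZMod q) ≃ (graph q).neighborSet x :=
  Equiv.ofBijective
    (fun o => match o with
      | none => ⟨x.pred, Or.inr rfl⟩
      | some s => ⟨x.succ s, Or.inl (by simp)⟩)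
    (by
      constructor
      · rintro (_ | s) (_ | t) h
        · rfl
        · have := congrArg HTree.hor (congrArg Subtype.val h)
          simp at this
          omega
        · have := congrArg HTree.hor (congrArg Subtype.val h)
          simp at this
          omega
        · exact congrArg some (succ_inj (congrArg Subtype.val h))
      · rintro ⟨y, h | h⟩
        · obtain ⟨s, rfl⟩ := eq_pred_iff.1 h
          exact ⟨some s, rfl⟩
        · subst h
          exact ⟨none, rfl⟩)

end HTree

/-- Vertices of the Diestel-Leader graph. -/
def DL (q r : ℕ) : Type := {x : HTree q × HTree r // x.1.hor + x.2.hor = 0}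

namespace DL

variable {q r : ℕ}

/-- The Diestel-Leader graph. -/
def graph (q r : ℕ) : SimpleGraph (DL q r) where
  Adj x y := (HTree.graph q).Adj x.1.1 y.1.1 ∧ (HTree.graph r).Adj x.1.2 y.1.2
  symm := ⟨fun _ _ h => ⟨h.1.symm, h.2.symm⟩⟩
  loopless := ⟨fun _ h => (HTree.graph q).loopless.irrefl _ h.1⟩

/-- Neighbours of `x₁x₂`: one moves to a successor of `x₁` and to the predecessor of `x₂`, or
vice versa. -/
noncomputable def nbrEquiv (x : DL q r) : ZMod q ⊕ ZMod r ≃ (graph q r).neighborSet x :=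
  Equiv.ofBijective
    (Sum.elim
      (fun s => ⟨⟨(x.1.1.succ s, x.1.2.pred), by have := x.2; simp; omega⟩,
        ⟨Or.inl (by simp), Or.inr rfl⟩⟩)
      (fun t => ⟨⟨(x.1.1.pred, x.1.2.succ t), by have := x.2; simp; omega⟩,
        ⟨Or.inr rfl, Or.inl (by simp)⟩⟩))
    (by
      constructor
      · rintro (s | s) (t | t) h
        · exact congrArg Sum.inl (HTree.succ_inj
            (congrArg (fun z : (graph q r).neighborSet x => z.1.1.1) h))
        · have := congrArg (fun z : (graph q r).neighborSet x => z.1.1.1.hor) h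
          simp at this
          omega
        · have := congrArg (fun z : (graph q r).neighborSet x => z.1.1.1.hor) h
          simp at this
          omega
        · exact congrArg Sum.inr (HTree.succ_inj
            (congrArg (fun z : (graph q r).neighborSet x => z.1.1.2) h))
      · rintro ⟨⟨⟨y₁, y₂⟩, hy⟩, h1, h2⟩
        have hx := x.2
        change y₁.hor + y₂.hor = 0 at hy
        change x.1.1 = y₁.pred ∨ y₁ = x.1.1.pred at h1
        change x.1.2 = y₂.pred ∨ y₂ = x.1.2.pred at h2
        rcases h1 with h1 | h1 <;> rcases h2 with h2 | h2
        · rw [h1, h2] at hx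
          simp at hx
          omega
        · obtain ⟨s, rfl⟩ := HTree.eq_pred_iff.1 h1
          subst h2
          exact ⟨Sum.inl s, rfl⟩
        · obtain ⟨s, rfl⟩ := HTree.eq_pred_iff.1 h2
          subst h1
          exact ⟨Sum.inr s, rfl⟩
        · rw [h1, h2] at hy
          simp at hy
          omega)

noncomputable instance [NeZero q] [NeZero r] : (graph q r).LocallyFinite :=
  fun x => Fintype.ofEquiv _ (nbrEquiv x)

theorem regular (q r : ℕ) [NeZero q] [NeZero r] :
    (graph q r).IsRegularOfDegree (q + r) := fun x => by
  rw [← SimpleGraph.card_neighborSet_eq_degree, ← Fintype.card_congr (nbrEquiv x)]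
  simp [ZMod.card]

end DL

/-! Simple random walk on a regular graph, as an operator on `ℓ²`. -/

/-- The complex Hilbert space of square summable functions on `V`. -/
abbrev EllTwo (V : Type) : Type := lp (fun _ : V => ℂ) 2

/-- The transition operator of simple random walk on functions:
`Pf(x)` is the mean of `f` over the neighbours of `x`. -/
noncomputable def srwFun {V : Type} (G : SimpleGraph V) [G.LocallyFinite] (f : V → ℂ) (x : V) : ℂ :=
  (∑ y ∈ G.neighborFinset x, f y) / (G.degree x : ℂ)

theorem srwFun_sum_sq_le {V : Type} (G : SimpleGraph V) [G.LocallyFinite] {d : ℕ}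
    (hG : G.IsRegularOfDegree d) (f : EllTwo V) (s : Finset V) :
    ∑ x ∈ s, ‖srwFun G f x‖ ^ 2 ≤ ‖f‖ ^ 2 := by
  classical
  rcases Nat.eq_zero_or_pos d with rfl | hd
  · have h0 : ∀ x, srwFun G f x = 0 := fun x => by simp [srwFun, hG x]
    simp only [h0]
    simp
  have hd' : (0 : ℝ) < d := by exact_mod_cast hd
  have h1 : ∀ x, ‖srwFun G f x‖ ^ 2 ≤ (∑ y ∈ G.neighborFinset x, ‖f y‖ ^ 2) / d := fun x => by
    have hcs := sq_sum_le_card_mul_sum_sq (s := G.neighborFinset x) (f := fun y => ‖f y‖)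
    rw [SimpleGraph.card_neighborFinset_eq_degree, hG x] at hcs
    have hn : ‖∑ y ∈ G.neighborFinset x, f y‖ ^ 2 ≤ (∑ y ∈ G.neighborFinset x, ‖f y‖) ^ 2 := by
      gcongr
      exact norm_sum_le _ _
    rw [srwFun, hG x, norm_div, div_pow, Complex.norm_natCast, div_le_div_iff₀ (by positivity) hd']
    nlinarith
  have h2 : ∑ x ∈ s, ∑ y ∈ G.neighborFinset x, ‖f y‖ ^ 2
      = ∑ y ∈ s.biUnion (fun x => G.neighborFinset x), ∑ x ∈ s.filter (fun x => G.Adj x y), ‖f y‖ ^ 2 := by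
    apply Finset.sum_comm'
    intro x y
    simp only [Finset.mem_biUnion, Finset.mem_filter, SimpleGraph.mem_neighborFinset]
    exact ⟨fun h => ⟨⟨h.1, h.2⟩, x, h⟩, fun h => h.1⟩
  have h3 : ∀ y, ∑ x ∈ s.filter (fun x => G.Adj x y), ‖f y‖ ^ 2 ≤ d * ‖f y‖ ^ 2 := fun y => by
    rw [Finset.sum_const, nsmul_eq_mul]
    gcongr
    rw [← hG y, ← SimpleGraph.card_neighborFinset_eq_degree]
    apply Finset.card_le_card
    intro x hx
    simpa using (Finset.mem_filter.1 hx).2.symm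
  have h4 : ∑ y ∈ s.biUnion (fun x => G.neighborFinset x), ‖f y‖ ^ 2 ≤ ‖f‖ ^ 2 := by
    have := lp.sum_rpow_le_norm_rpow (p := 2) (by norm_num) f (s.biUnion (fun x => G.neighborFinset x))
    simpa using this
  calc ∑ x ∈ s, ‖srwFun G f x‖ ^ 2
      ≤ ∑ x ∈ s, (∑ y ∈ G.neighborFinset x, ‖f y‖ ^ 2) / d := Finset.sum_le_sum fun x _ => h1 x
    _ = (∑ x ∈ s, ∑ y ∈ G.neighborFinset x, ‖f y‖ ^ 2) / d := by rw [Finset.sum_div]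
    _ ≤ (∑ y ∈ s.biUnion (fun x => G.neighborFinset x), d * ‖f y‖ ^ 2) / d := by
        rw [h2]
        gcongr with y hy
        exact h3 y
    _ = ∑ y ∈ s.biUnion (fun x => G.neighborFinset x), ‖f y‖ ^ 2 := by
        rw [← Finset.mul_sum]
        field_simp
    _ ≤ ‖f‖ ^ 2 := h4

theorem srwFun_memℓp {V : Type} (G : SimpleGraph V) [G.LocallyFinite] {d : ℕ}
    (hG : G.IsRegularOfDegree d) (f : EllTwo V) : Memℓp (srwFun G f) 2 := by
  apply memℓp_gen' (C := ‖f‖ ^ 2)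
  intro s
  simpa using srwFun_sum_sq_le G hG f s

/-- The transition operator of simple random walk on a regular graph, as a bounded linear operator
on `ℓ²`. -/
noncomputable def srw {V : Type} (G : SimpleGraph V) [G.LocallyFinite] {d : ℕ}
    (hG : G.IsRegularOfDegree d) : EllTwo V →L[ℂ] EllTwo V :=
  LinearMap.mkContinuous
    { toFun := fun f => ⟨srwFun G f, srwFun_memℓp G hG f⟩
      map_add' := fun f g => by
        ext x
        change srwFun G (⇑f + ⇑g) x = srwFun G f x + srwFun G g x
        simp [srwFun, Finset.sum_add_distrib, add_div]
      map_smul' := fun c f => by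
        ext x
        change srwFun G (c • ⇑f) x = c * srwFun G f x
        simp [srwFun, ← Finset.mul_sum, mul_div_assoc] }
    1
    (fun f => by
      rw [one_mul]
      apply lp.norm_le_of_forall_sum_le (p := 2) (by norm_num) (norm_nonneg f)
      intro s
      simpa using srwFun_sum_sq_le G hG f s)

/-- The transition operator `P` of simple random walk on the Diestel-Leader graph. -/
noncomputable def DL.P (q r : ℕ) [NeZero q] [NeZero r] : EllTwo (DL q r) →L[ℂ] EllTwo (DL q r) :=
  srw (DL.graph q r) (DL.regular q r)

/-! Tetrahedra and the functions built on them. -/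

/-- A tetrahedron in the Diestel-Leader graph, given by its two corners `a₁`, `a₂` and its
height `n`, where `-hor(a₂) = hor(a₁) + n`. -/
structure Tetrahedron (q r : ℕ) where
  a₁ : HTree q
  a₂ : HTree r
  height : ℕ
  hor_eq : -a₂.hor = a₁.hor + height

/-- The set of vertices of the tetrahedron. -/
def Tetrahedron.verts {q r : ℕ} (S : Tetrahedron q r) : Set (DL q r) :=
  {x | HTree.Above S.a₁ x.1.1 ∧ HTree.Above S.a₂ x.1.2}

open Classical in
/-- The function `f_k[φ]` on the tree, with respect to the vertex `a`: it is `0` for `k = 0`, and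
for `k ≥ 1` it has the value `φ(s) q^((1-k)/2)` at the vertices `x` of level `hor a + k` that lie
below the successor of `a` with label `s` (there is at most one such `s`), and `0` elsewhere. -/
noncomputable def treeFun {q : ℕ} [NeZero q] (φ : ZMod q → ℝ) (a : HTree q) (k : ℕ)
    (x : HTree q) : ℝ :=
  if k = 0 then 0
  else ∑ s : ZMod q, if HTree.Above (a.succ s) x ∧ x.hor = a.hor + k
    then φ s * (q : ℝ) ^ ((1 - (k : ℝ)) / 2) else 0

/-- The function `φ_i` on `ℤ_q = {0, …, q-1}`, for `1 ≤ i ≤ q - 1`. -/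
noncomputable def phi (q i : ℕ) (s : ZMod q) : ℝ :=
  if s.val + 1 = i then ((q : ℝ) - i) / √(((q : ℝ) - i) * ((q : ℝ) + 1 - i))
  else if i ≤ s.val then -1 / √(((q : ℝ) - i) * ((q : ℝ) + 1 - i))
  else 0

open Classical in
/-- The function `f_k[S, φ¹, φ²]` on the tetrahedron `S`, extended by `0`. -/
noncomputable def fFun {q r : ℕ} [NeZero q] [NeZero r] (S : Tetrahedron q r) (φ₁ : ZMod q → ℝ)
    (φ₂ : ZMod r → ℝ) (k : ℕ) (x : DL q r) : ℝ :=
  if x ∈ S.verts then treeFun φ₁ S.a₁ k x.1.1 * treeFun φ₂ S.a₂ (S.height - k) x.1.2 else 0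

/-- The coefficients `ψ_{m,n}(k)`. -/
noncomputable def psi (m n k : ℕ) : ℝ := √(2 / (n : ℝ)) * Real.sin ((k : ℝ) * m / n * Real.pi)

/-- The function `g_m[S, φ¹, φ²]`. -/
noncomputable def gFun {q r : ℕ} [NeZero q] [NeZero r] (S : Tetrahedron q r) (φ₁ : ZMod q → ℝ)
    (φ₂ : ZMod r → ℝ) (m : ℕ) (x : DL q r) : ℝ :=
  ∑ k ∈ Finset.Icc 1 (S.height - 1), psi m S.height k * fFun S φ₁ φ₂ k x

/-- The index set of the system of functions `g_m^{[S,i,j]}`: `S` is a tetrahedron,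
`1 ≤ m ≤ n(S) - 1` (so that `n(S) ≥ 2`), `1 ≤ i ≤ q - 1` and `1 ≤ j ≤ r - 1`. -/
structure GIndex (q r : ℕ) where
  S : Tetrahedron q r
  m : ℕ
  i : ℕ
  j : ℕ
  one_le_m : 1 ≤ m
  m_lt : m < S.height
  one_le_i : 1 ≤ i
  i_lt : i < q
  one_le_j : 1 ≤ j
  j_lt : j < r

/-- The function `g_m^{[S,i,j]} = g_m[S, φ_i, φ_j]`. -/
noncomputable def GIndex.fn {q r : ℕ} [NeZero q] [NeZero r] (t : GIndex q r) : DL q r → ℝ :=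
  gFun t.S (phi q t.i) (phi r t.j) t.m

/-- `ρ = 2√(qr)/(q+r)`. -/
noncomputable def rho (q r : ℕ) : ℝ := 2 * √((q : ℝ) * r) / ((q : ℝ) + r)

/-- `λ_{m,n} = ρ cos(mπ/n)`. -/
noncomputable def lam (q r m n : ℕ) : ℝ := rho q r * Real.cos ((m : ℝ) / n * Real.pi)

/-- The set of all `λ_{m,n}`, where `n ≥ 2` and `1 ≤ m ≤ n - 1`. -/
def lamSet (q r : ℕ) : Set ℝ := {l | ∃ n m : ℕ, 2 ≤ n ∧ 1 ≤ m ∧ m ≤ n - 1 ∧ l = lam q r m n}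

/-!
The functions `f_k[φ]` on a single horocyclic tree are Haar wavelets. On a horocycle of `T_q`, the
wavelets `f_k[φ_i]` with all apexes `k ≥ 1` levels above it are orthonormal: two wavelets of
different depth are orthogonal because the deeper one is constant on the support of the other
(`hasSum_treeFun_mul_treeFun`). They are complete because the difference of the normalized averages
over two consecutive balls around a vertex is a wavelet (`horoAvg_sub_horoAvg_succ`), while the
averages over larger and larger balls tend to `0` in norm.

On the part of the Diestel-Leader graph with a fixed level in the first tree, which is the product
of two horocycles, tensor products of wavelets are thus an orthonormal basis. A pair of apexes
`(a₁, a₂)` at distances `k ≥ 1` and `l ≥ 1` from the level is exactly a tetrahedron of height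
`n = k + l`, so over all levels these tensor products are the functions `f_k[S, φ_i, φ_j]` with
`1 ≤ k ≤ n(S) - 1`. For fixed `S`, `i`, `j` their span is invariant under `P`: on it, `P` is
`√(qr)/(q+r)` times the adjacency operator of a path with `n - 1` vertices (`srwFun_gFun`). The
symmetric orthogonal matrix of the discrete sine transform diagonalizes the path, with eigenvalues
`2 cos(mπ/n)` (`sum_psi_mul_psi`, `psi_add_psi`). Hence the functions `g_m` form a Hilbert basis of
eigenvectors.

The statements on the spectrum hold for every bounded operator that is diagonal in a Hilbert basis
(`HilbertBasis.spectrum_of_diagonal`), given that the numbers `cos(xπ)` with rational `x ∈ (0, 1)`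
are dense in `[-1, 1]`.
-/

/-! ### Descendants and the functions on one tree -/

namespace HTree

variable {q : ℕ}

theorem iterate_pred_eq_succ_iff {k : ℕ} {x a : HTree q} {s : ZMod q} :
    pred^[k] x = a.succ s ↔ pred^[k + 1] x = a ∧ x.label k = s := by
  constructor
  · intro h
    refine ⟨by rw [Function.iterate_succ_apply', h, pred_succ], ?_⟩
    have := congrArg (fun y : HTree q => y.label 0) h
    simpa [label_iterate_pred, succ] using this
  · rintro ⟨rfl, rfl⟩
    have := succ_pred (pred^[k] x)
    rw [label_iterate_pred, Nat.zero_add] at this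
    rw [Function.iterate_succ_apply', this]

theorem iterate_pred_eq_iff_succ {k : ℕ} {x y : HTree q} :
    pred^[k] y = pred^[k] x ↔ pred^[k + 1] y = pred^[k + 1] x ∧ y.label k = x.label k := by
  rw [← iterate_pred_eq_succ_iff, (iterate_pred_eq_succ_iff (x := x)).2 ⟨rfl, rfl⟩]

theorem above_and_hor_iff {x a : HTree q} {k : ℕ} :
    (Above a x ∧ x.hor = a.hor + k) ↔ pred^[k] x = a := by
  constructor
  · rintro ⟨⟨l, rfl⟩, h⟩
    rw [hor_iterate_pred] at h
    rw [show k = l by omega]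
  · rintro rfl
    exact ⟨⟨k, rfl⟩, by rw [hor_iterate_pred]; ring⟩

theorem label_zero_succ (x : HTree q) (s : ZMod q) : (x.succ s).label 0 = s := rfl

theorem label_succ_succ (x : HTree q) (s : ZMod q) (n : ℕ) :
    (x.succ s).label (n + 1) = x.label n := rfl

variable [NeZero q]

open Classical in
/-- The vertices `x` that lie `k` generations below `a`, that is, `pred^[k] x = a`. -/
noncomputable def descendants : ℕ → HTree q → Finset (HTree q)
  | 0, a => {a}
  | k + 1, a => Finset.univ.biUnion fun s => descendants k (a.succ s)

theorem mem_descendants {k : ℕ} {a x : HTree q} : x ∈ descendants k a ↔ pred^[k] x = a := by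
  induction k generalizing a with
  | zero => simp [descendants]
  | succ k ih =>
    simp only [descendants, Finset.mem_biUnion, Finset.mem_univ, true_and, ih,
      Function.iterate_succ_apply', ← eq_pred_iff]
    exact eq_comm

theorem sum_descendants_succ (k : ℕ) (a : HTree q) (f : HTree q → ℝ) :
    ∑ x ∈ descendants (k + 1) a, f x = ∑ s, ∑ x ∈ descendants k (a.succ s), f x := by
  classical
  rw [descendants, Finset.sum_biUnion]
  intro s _ t _ hst
  refine Finset.disjoint_left.2 fun x hx hx' => hst ?_
  exact succ_inj ((mem_descendants.1 hx).symm.trans (mem_descendants.1 hx'))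

theorem card_descendants (k : ℕ) (a : HTree q) : ((descendants k a).card : ℝ) = (q : ℝ) ^ k := by
  induction k generalizing a with
  | zero => simp [descendants]
  | succ k ih =>
    have := sum_descendants_succ k a fun _ => 1
    simp only [Finset.sum_const, nsmul_eq_mul, mul_one, ih, Finset.card_univ, ZMod.card] at this
    rw [this, pow_succ']

end HTree

section TreeFun

open HTree

variable {q : ℕ} [NeZero q]

theorem treeFun_zero (φ : ZMod q → ℝ) (a x : HTree q) : treeFun φ a 0 x = 0 := by simp [treeFun]

open Classical in
/-- For `x` at depth `k + 1` below `a`, the edge from `a` towards `x` has the label `x.label k`. -/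
theorem treeFun_succ (φ : ZMod q → ℝ) (a : HTree q) (k : ℕ) (x : HTree q) :
    treeFun φ a (k + 1) x
      = if pred^[k + 1] x = a then φ (x.label k) * (√(q : ℝ))⁻¹ ^ k else 0 := by
  have hq : (0 : ℝ) ≤ q := Nat.cast_nonneg q
  have hpow : (q : ℝ) ^ ((1 - ((k + 1 : ℕ) : ℝ)) / 2) = (√(q : ℝ))⁻¹ ^ k := by
    rw [Real.sqrt_eq_rpow, ← Real.rpow_neg hq, ← Real.rpow_natCast, ← Real.rpow_mul hq]
    congr 1
    push_cast
    ring
  have hcond : ∀ s, (Above (a.succ s) x ∧ x.hor = a.hor + ((k + 1 : ℕ) : ℤ)) ↔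
      pred^[k + 1] x = a ∧ x.label k = s := by
    intro s
    rw [← iterate_pred_eq_succ_iff, ← above_and_hor_iff, hor_succ]
    push_cast
    rw [show a.hor + 1 + (k : ℤ) = a.hor + (k + 1) by ring]
  simp only [treeFun, Nat.add_one_ne_zero, if_false, hcond, hpow]
  by_cases h : pred^[k + 1] x = a <;> simp [h, -Function.iterate_succ]

theorem treeFun_of_eq (φ : ZMod q → ℝ) {a x : HTree q} {k : ℕ} (h : pred^[k + 1] x = a) :
    treeFun φ a (k + 1) x = φ (x.label k) * (√(q : ℝ))⁻¹ ^ k := by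
  rw [treeFun_succ, if_pos h]

theorem treeFun_of_ne (φ : ZMod q → ℝ) {a x : HTree q} {k : ℕ} (h : pred^[k] x ≠ a) :
    treeFun φ a k x = 0 := by
  cases k with
  | zero => exact treeFun_zero φ a x
  | succ k => rw [treeFun_succ, if_neg h]

theorem iterate_pred_of_treeFun_ne_zero {φ : ZMod q → ℝ} {a x : HTree q} {k : ℕ}
    (h : treeFun φ a k x ≠ 0) : pred^[k] x = a := by
  by_contra hne
  exact h (treeFun_of_ne φ hne)

theorem hor_of_treeFun_ne_zero {φ : ZMod q → ℝ} {a x : HTree q} {k : ℕ}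
    (h : treeFun φ a k x ≠ 0) : x.hor = a.hor + k :=
  (above_and_hor_iff.2 (iterate_pred_of_treeFun_ne_zero h)).2

theorem treeFun_add (φ φ' : ZMod q → ℝ) (a : HTree q) (k : ℕ) (x : HTree q) :
    treeFun (φ + φ') a k x = treeFun φ a k x + treeFun φ' a k x := by
  cases k with
  | zero => simp [treeFun_zero]
  | succ k => simp only [treeFun_succ]; split_ifs <;> simp [add_mul]

theorem treeFun_smul (c : ℝ) (φ : ZMod q → ℝ) (a : HTree q) (k : ℕ) (x : HTree q) :
    treeFun (c • φ) a k x = c * treeFun φ a k x := by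
  cases k with
  | zero => simp [treeFun_zero]
  | succ k => simp only [treeFun_succ]; split_ifs <;> simp [mul_assoc]

theorem sqrt_natCast_pos : 0 < √(q : ℝ) :=
  Real.sqrt_pos.2 (Nat.cast_pos.2 (NeZero.pos q))

/-- Averaging over the successors lowers the depth by one. At depth `1` the outcome is
`0 = f_0[φ]`, because `φ` has sum `0`. -/
theorem sum_treeFun_succ {φ : ZMod q → ℝ} (hφ : ∑ s, φ s = 0) (a : HTree q) (k : ℕ)
    (x : HTree q) :
    ∑ s, treeFun φ a (k + 1) (x.succ s) = √(q : ℝ) * treeFun φ a k x := by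
  have hq := sqrt_natCast_pos (q := q)
  have hit : ∀ s, pred^[k + 1] (x.succ s) = pred^[k] x := fun s => by
    rw [Function.iterate_succ_apply, pred_succ]
  by_cases h : pred^[k] x = a
  · rw [Finset.sum_congr rfl fun s _ => treeFun_of_eq φ ((hit s).trans h)]
    cases k with
    | zero => simp [label_zero_succ, treeFun_zero, hφ]
    | succ k =>
      simp only [label_succ_succ]
      rw [treeFun_of_eq φ h, Finset.sum_const, Finset.card_univ, ZMod.card, nsmul_eq_mul, pow_succ]
      nth_rewrite 1 [← Real.mul_self_sqrt (Nat.cast_nonneg q)]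
      field_simp
  · rw [Finset.sum_congr rfl fun s _ => treeFun_of_ne φ (by rwa [hit s]), treeFun_of_ne φ h]
    simp

theorem treeFun_pred (φ : ZMod q → ℝ) (a : HTree q) {k : ℕ} (hk : k ≠ 0) (x : HTree q) :
    treeFun φ a k x.pred = √(q : ℝ) * treeFun φ a (k + 1) x := by
  have hq := sqrt_natCast_pos (q := q)
  obtain ⟨k, rfl⟩ := Nat.exists_eq_succ_of_ne_zero hk
  by_cases h : pred^[k + 1] x.pred = a
  · rw [treeFun_of_eq φ h, treeFun_of_eq φ (by rwa [Function.iterate_succ_apply]),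
      show x.pred.label k = x.label (k + 1) from rfl, pow_succ]
    field_simp
  · rw [treeFun_of_ne φ h, treeFun_of_ne φ (by rwa [Function.iterate_succ_apply]), mul_zero]

theorem hasSum_descendants {f : HTree q → ℝ} {k : ℕ} {a : HTree q}
    (hf : ∀ x, pred^[k] x ≠ a → f x = 0) : HasSum f (∑ x ∈ descendants k a, f x) :=
  hasSum_sum_of_ne_finset_zero fun x hx => hf x fun h => hx (mem_descendants.2 h)

theorem sum_descendants_treeFun (φ : ZMod q → ℝ) (a : HTree q) (k : ℕ) :
    ∑ x ∈ descendants (k + 1) a, treeFun φ a (k + 1) x = (√(q : ℝ)) ^ k * ∑ s, φ s := by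
  have hq := sqrt_natCast_pos (q := q)
  rw [sum_descendants_succ, Finset.mul_sum]
  refine Finset.sum_congr rfl fun s _ => ?_
  rw [Finset.sum_congr rfl (g := fun _ => φ s * (√(q : ℝ))⁻¹ ^ k), Finset.sum_const,
    nsmul_eq_mul, card_descendants]
  · nth_rewrite 1 [← Real.mul_self_sqrt (Nat.cast_nonneg q)]
    rw [mul_pow, inv_pow]
    field_simp
  · intro x hx
    obtain ⟨h1, h2⟩ := iterate_pred_eq_succ_iff.1 (mem_descendants.1 hx)
    rw [treeFun_succ, if_pos h1, h2]

/-- Functions of different depth are orthogonal: below the apex `a` of the shallower one the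
deeper one is constant, and the shallower one has sum `0`. -/
theorem hasSum_treeFun_mul_treeFun_of_lt {φ φ' : ZMod q → ℝ} (hφ : ∑ s, φ s = 0)
    (a a' : HTree q) {k k' : ℕ} (hk : k < k') :
    HasSum (fun x => treeFun φ a (k + 1) x * treeFun φ' a' (k' + 1) x) 0 := by
  classical
  obtain ⟨l, rfl⟩ := Nat.exists_eq_add_of_lt hk
  have h := hasSum_descendants (f := fun x => treeFun φ a (k + 1) x * treeFun φ' a' (k + l + 1 + 1) x)
    (k := k + 1) (a := a) fun x hx => by
      rw [treeFun_succ φ, if_neg hx, zero_mul]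
  convert h
  rw [Finset.sum_congr rfl (g := fun x => treeFun φ a (k + 1) x *
    (if pred^[l + 1] a = a' then φ' (a.label l) * (√(q : ℝ))⁻¹ ^ (k + l + 1) else 0)),
    ← Finset.sum_mul, sum_descendants_treeFun, hφ, mul_zero, zero_mul]
  intro x hx
  rw [treeFun_succ φ', ← mem_descendants.1 hx, ← Function.iterate_add_apply, label_iterate_pred,
    show l + 1 + (k + 1) = k + l + 1 + 1 by ring, show l + (k + 1) = k + l + 1 by ring]

open Classical in
/-- The functions `f_k[φ]` on one tree, taken over all apexes `a` and all `k ≥ 1`, form an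
orthogonal family of Haar type. -/
theorem hasSum_treeFun_mul_treeFun {φ φ' : ZMod q → ℝ} (hφ : ∑ s, φ s = 0)
    (hφ' : ∑ s, φ' s = 0) (a a' : HTree q) {k k' : ℕ} (hk : k ≠ 0) (hk' : k' ≠ 0) :
    HasSum (fun x => treeFun φ a k x * treeFun φ' a' k' x)
      (if a = a' ∧ k = k' then ∑ s, φ s * φ' s else 0) := by
  obtain ⟨k, rfl⟩ := Nat.exists_eq_succ_of_ne_zero hk
  obtain ⟨k', rfl⟩ := Nat.exists_eq_succ_of_ne_zero hk'
  simp only [Nat.succ_eq_add_one]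
  rcases lt_trichotomy k k' with h | rfl | h
  · rw [if_neg (by omega)]
    exact hasSum_treeFun_mul_treeFun_of_lt hφ a a' h
  · by_cases ha : a = a'
    · subst ha
      rw [if_pos ⟨rfl, rfl⟩]
      have hmul : ∀ x, treeFun φ a (k + 1) x * treeFun φ' a (k + 1) x
          = (√(q : ℝ))⁻¹ ^ k * treeFun (fun s => φ s * φ' s) a (k + 1) x := by
        intro x
        simp only [treeFun_succ]
        split_ifs
        · ring
        · simp
      have h := hasSum_descendants (f := fun x => treeFun φ a (k + 1) x * treeFun φ' a (k + 1) x)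
        (k := k + 1) (a := a) fun x hx => by
          rw [treeFun_succ φ, if_neg hx, zero_mul]
      convert h
      have hq := sqrt_natCast_pos (q := q)
      simp only [hmul]
      rw [← Finset.mul_sum, sum_descendants_treeFun, ← mul_assoc, ← mul_pow,
        inv_mul_cancel₀ hq.ne', one_pow, one_mul]
    · rw [if_neg (by tauto)]
      convert hasSum_zero using 2 with x
      by_contra hne
      obtain ⟨h1, h2⟩ := ne_zero_and_ne_zero_of_mul hne
      exact ha ((iterate_pred_of_treeFun_ne_zero h1).symm.trans (iterate_pred_of_treeFun_ne_zero h2))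
  · rw [if_neg (by omega)]
    simpa only [mul_comm] using hasSum_treeFun_mul_treeFun_of_lt (φ := φ') (φ' := φ) hφ' a' a h

theorem finite_support_treeFun (φ : ZMod q → ℝ) (a : HTree q) (k : ℕ) :
    (Function.support (treeFun φ a k)).Finite :=
  (descendants k a).finite_toSet.subset fun _ hx =>
    Finset.mem_coe.2 (mem_descendants.2 (iterate_pred_of_treeFun_ne_zero hx))

end TreeFun

/-! ### Averages over balls of a horocycle -/

section HoroAvg

open HTree

variable {q : ℕ}

open Classical in
/-- The normalized indicator function of the ball of `q ^ k` vertices that have the same `k`-th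
predecessor as `x`; these all lie on the horocycle of `x`. -/
noncomputable def horoAvg (x : HTree q) (k : ℕ) (y : HTree q) : ℝ :=
  if pred^[k] y = pred^[k] x then ((q : ℝ) ^ k)⁻¹ else 0

theorem hor_of_horoAvg_ne_zero {x y : HTree q} {k : ℕ} (h : horoAvg x k y ≠ 0) :
    y.hor = x.hor := by
  have h' : pred^[k] y = pred^[k] x := by
    by_contra hne
    exact h (if_neg hne)
  have := congrArg HTree.hor h'
  simp only [hor_iterate_pred] at this
  omega

open Classical in
/-- The difference of two consecutive averages is a function of Haar type. -/
theorem horoAvg_sub_horoAvg_succ [NeZero q] (x y : HTree q) (k : ℕ) :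
    horoAvg x k y - horoAvg x (k + 1) y
      = (√(q : ℝ))⁻¹ ^ k * treeFun (fun s => (if s = x.label k then 1 else 0) - (q : ℝ)⁻¹)
          (pred^[k + 1] x) (k + 1) y := by
  have hq : (√(q : ℝ))⁻¹ ^ k * (√(q : ℝ))⁻¹ ^ k = ((q : ℝ) ^ k)⁻¹ := by
    rw [← mul_pow, ← mul_inv, Real.mul_self_sqrt (Nat.cast_nonneg q), inv_pow]
  simp only [horoAvg, treeFun_succ, iterate_pred_eq_iff_succ (k := k)]
  by_cases h : pred^[k + 1] y = pred^[k + 1] x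
  · simp only [h, true_and, if_true, mul_left_comm _ (_ - _), hq, pow_succ, mul_inv]
    split_ifs <;> ring
  · simp [h, -Function.iterate_succ]

theorem hasSum_horoAvg_mul_horoAvg [NeZero q] (x : HTree q) {k l : ℕ} (h : k ≤ l) :
    HasSum (fun y => horoAvg x k y * horoAvg x l y) ((q : ℝ) ^ l)⁻¹ := by
  have hq : (q : ℝ) ≠ 0 := Nat.cast_ne_zero.2 (NeZero.ne q)
  have hs := hasSum_descendants (f := fun y => horoAvg x k y * horoAvg x l y) (k := k)
    (a := pred^[k] x) fun y hy => by rw [horoAvg, if_neg hy, zero_mul]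
  convert hs
  rw [Finset.sum_congr rfl (g := fun _ => ((q : ℝ) ^ k)⁻¹ * ((q : ℝ) ^ l)⁻¹), Finset.sum_const,
    nsmul_eq_mul, card_descendants, mul_inv_cancel_left₀ (pow_ne_zero k hq)]
  intro y hy
  have hk := mem_descendants.1 hy
  have hl : pred^[l] y = pred^[l] x := by
    obtain ⟨m, rfl⟩ := Nat.exists_eq_add_of_le' h
    rw [Function.iterate_add_apply, hk, ← Function.iterate_add_apply]
  rw [horoAvg, horoAvg, if_pos hk, if_pos hl]

end HoroAvg

/-! ### The orthonormal functions `phi` on the labels -/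

section Phi

theorem ZMod.sum_comp_val {q : ℕ} [NeZero q] (f : ℕ → ℝ) :
    ∑ s : ZMod q, f s.val = ∑ s ∈ Finset.range q, f s := by
  obtain ⟨n, rfl⟩ := Nat.exists_eq_succ_of_ne_zero (NeZero.ne q)
  exact Fin.sum_univ_eq_sum_range f (n + 1)

theorem sum_range_step {q i : ℕ} (hi : 1 ≤ i) (hiq : i < q) (A B : ℝ) :
    ∑ s ∈ Finset.range q, (if s + 1 = i then A else if i ≤ s then B else 0) = A + (q - i) * B := by
  have hsplit : ∀ s, (if s + 1 = i then A else if i ≤ s then B else 0)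
      = (if s = i - 1 then A else 0) + if i ≤ s then B else 0 := by
    intro s
    by_cases h : s + 1 = i
    · rw [if_pos h, if_pos (by omega), if_neg (by omega), add_zero]
    · rw [if_neg h, if_neg (by omega : ¬ s = i - 1), zero_add]
  have hfilter : (Finset.range q).filter (fun s => i ≤ s) = Finset.Ico i q := by
    ext s
    simp only [Finset.mem_filter, Finset.mem_range, Finset.mem_Ico]
    omega
  simp only [hsplit]
  rw [Finset.sum_add_distrib, Finset.sum_ite_eq', if_pos (Finset.mem_range.2 (by omega)),
    ← Finset.sum_filter, hfilter, Finset.sum_const, Nat.card_Ico, nsmul_eq_mul,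
    Nat.cast_sub hiq.le]

variable {q : ℕ} [NeZero q]

theorem sum_phi {i : ℕ} (hi : 1 ≤ i) (hiq : i < q) : ∑ s, phi q i s = 0 := by
  refine (ZMod.sum_comp_val _).trans ((sum_range_step hi hiq _ _).trans ?_)
  ring

theorem sum_phi_mul_self {i : ℕ} (hi : 1 ≤ i) (hiq : i < q) :
    ∑ s, phi q i s * phi q i s = 1 := by
  have hpos : (0 : ℝ) < (q : ℝ) - i := sub_pos.2 (Nat.cast_lt.2 hiq)
  have hD : √(((q : ℝ) - i) * ((q : ℝ) + 1 - i)) ^ 2 = ((q : ℝ) - i) * ((q : ℝ) + 1 - i) :=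
    Real.sq_sqrt (mul_nonneg hpos.le (by linarith))
  have hD0 : √(((q : ℝ) - i) * ((q : ℝ) + 1 - i)) ≠ 0 :=
    (Real.sqrt_pos.2 (mul_pos hpos (by linarith))).ne'
  have hne : (q : ℝ) + 1 - i ≠ 0 := by linarith
  have hsq : ∀ s : ZMod q, phi q i s * phi q i s
      = if s.val + 1 = i then (((q : ℝ) - i) / √(((q : ℝ) - i) * ((q : ℝ) + 1 - i))) ^ 2
        else if i ≤ s.val then (-1 / √(((q : ℝ) - i) * ((q : ℝ) + 1 - i))) ^ 2 else 0 := by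
    intro s
    rw [phi]
    split_ifs <;> ring
  simp only [hsq]
  refine (ZMod.sum_comp_val _).trans ((sum_range_step hi hiq _ _).trans ?_)
  rw [div_pow, div_pow, hD]
  field_simp
  ring

theorem sum_phi_mul_phi_of_lt {i j : ℕ} (hij : i < j) (hi : 1 ≤ i) (hjq : j < q) :
    ∑ s, phi q i s * phi q j s = 0 := by
  have h : ∀ s, phi q i s * phi q j s
      = (-1 / √(((q : ℝ) - i) * ((q : ℝ) + 1 - i))) * phi q j s := by
    intro s
    by_cases hs : j ≤ s.val + 1
    · rw [phi, if_neg (by omega), if_pos (by omega)]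
    · have : phi q j s = 0 := by rw [phi, if_neg (by omega), if_neg (by omega)]
      rw [this, mul_zero, mul_zero]
  simp only [h]
  rw [← Finset.mul_sum, sum_phi (by omega) hjq, mul_zero]

theorem sum_phi_mul_phi {i j : ℕ} (hi : 1 ≤ i) (hiq : i < q) (hj : 1 ≤ j) (hjq : j < q) :
    ∑ s, phi q i s * phi q j s = if i = j then 1 else 0 := by
  rcases lt_trichotomy i j with h | rfl | h
  · rw [if_neg h.ne, sum_phi_mul_phi_of_lt h hi hjq]
  · rw [if_pos rfl, sum_phi_mul_self hi hiq]
  · simp only [mul_comm (phi q i _)]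
    rw [if_neg h.ne', sum_phi_mul_phi_of_lt h hj hiq]

/-- Together with the constant `1/√q` the functions `phi q i` are the rows of an orthogonal matrix,
so its columns are orthonormal as well: this is Parseval's identity for point masses. -/
theorem sum_phi_mul_phi_dual (s t : ZMod q) :
    ∑ i ∈ Finset.univ.erase (0 : ZMod q), phi q i.val t * phi q i.val s
      = (if s = t then 1 else 0) - (q : ℝ)⁻¹ := by
  classical
  have hq : (q : ℝ) ≠ 0 := Nat.cast_ne_zero.2 (NeZero.ne q)
  have hss : (√(q : ℝ))⁻¹ * (√(q : ℝ))⁻¹ = (q : ℝ)⁻¹ := by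
    rw [← mul_inv, Real.mul_self_sqrt (Nat.cast_nonneg q)]
  have hval : ∀ i : ZMod q, i ≠ 0 → 1 ≤ i.val := fun i hi =>
    Nat.one_le_iff_ne_zero.2 fun h => hi ((ZMod.val_eq_zero i).1 h)
  let M : Matrix (ZMod q) (ZMod q) ℝ :=
    Matrix.of fun i s => if i = 0 then (√(q : ℝ))⁻¹ else phi q i.val s
  have hM : M * M.transpose = 1 := by
    ext i j
    rw [Matrix.mul_apply, Matrix.one_apply]
    simp only [Matrix.transpose_apply, M, Matrix.of_apply]
    by_cases hi : i = 0 <;> by_cases hj : j = 0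
    · simp [hi, hj, hss, ZMod.card, hq]
    · simp only [hi, hj, if_true, if_false]
      rw [← Finset.mul_sum, sum_phi (hval j hj) (ZMod.val_lt j), mul_zero, if_neg (Ne.symm hj)]
    · simp only [hi, hj, if_true, if_false]
      rw [← Finset.sum_mul, sum_phi (hval i hi) (ZMod.val_lt i), zero_mul]
    · simp only [hi, hj, if_false]
      rw [sum_phi_mul_phi (hval i hi) (ZMod.val_lt i) (hval j hj) (ZMod.val_lt j)]
      simp only [(ZMod.val_injective q).eq_iff]
  have hM' := Matrix.ext_iff.2 (mul_eq_one_comm.1 hM) t s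
  rw [Matrix.mul_apply, Matrix.one_apply, ← Finset.add_sum_erase _ _ (Finset.mem_univ 0)] at hM'
  simp only [Matrix.transpose_apply, M, Matrix.of_apply, if_true, hss] at hM'
  rw [Finset.sum_congr rfl (g := fun i : ZMod q => phi q i.val t * phi q i.val s) fun i hi => by
    simp only [Finset.ne_of_mem_erase hi, if_false]] at hM'
  simp only [eq_comm (a := s)]
  linarith

end Phi

/-! ### The discrete sine functions `psi` -/

section Psi

theorem two_mul_sin_mul_sum_cos (θ : ℝ) (n : ℕ) :
    2 * Real.sin (θ / 2) * ∑ k ∈ Finset.range n, Real.cos (k * θ)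
      = Real.sin (n * θ - θ / 2) + Real.sin (θ / 2) := by
  induction n with
  | zero => simp
  | succ n ih =>
    have h : 2 * Real.sin (θ / 2) * Real.cos (n * θ)
        = Real.sin (n * θ + θ / 2) - Real.sin (n * θ - θ / 2) := by
      rw [Real.sin_add, Real.sin_sub]
      ring
    rw [Finset.sum_range_succ, mul_add, ih, h,
      show ((n + 1 : ℕ) : ℝ) * θ - θ / 2 = n * θ + θ / 2 by push_cast; ring]
    ring

theorem sum_cos_mul_pi_div {n j : ℕ} (hj : 0 < j) (hjn : j < 2 * n) :
    ∑ k ∈ Finset.range n, Real.cos (k * (j * Real.pi / n)) = (1 - (-1) ^ j) / 2 := by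
  have hn : (0 : ℝ) < n := Nat.cast_pos.2 (by omega)
  have hj' : (0 : ℝ) < j := Nat.cast_pos.2 hj
  have hjn' : (j : ℝ) < 2 * n := by exact_mod_cast hjn
  have h := two_mul_sin_mul_sum_cos (j * Real.pi / n) n
  have hpos : 0 < Real.sin (j * Real.pi / n / 2) := by
    apply Real.sin_pos_of_pos_of_lt_pi
    · positivity
    · rw [div_div, div_lt_iff₀ (by positivity)]
      nlinarith [Real.pi_pos]
  rw [mul_div_cancel₀ _ hn.ne', Real.sin_sub, Real.sin_nat_mul_pi, Real.cos_nat_mul_pi] at h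
  have : 2 * Real.sin (j * Real.pi / n / 2) *
      (∑ k ∈ Finset.range n, Real.cos (k * (j * Real.pi / n)) - (1 - (-1) ^ j) / 2) = 0 := by
    rw [mul_sub, h]
    ring
  rcases mul_eq_zero.1 this with h0 | h0
  · linarith
  · linarith

theorem sum_sin_mul_sin_of_le {n m m' : ℕ} (hm' : 1 ≤ m') (hle : m' ≤ m) (hmn : m < n) :
    ∑ k ∈ Finset.range n, Real.sin (k * m / n * Real.pi) * Real.sin (k * m' / n * Real.pi)
      = if m = m' then (n : ℝ) / 2 else 0 := by
  have hterm : ∀ k : ℕ, Real.sin (k * m / n * Real.pi) * Real.sin (k * m' / n * Real.pi)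
      = (Real.cos (k * ((m - m' : ℕ) * Real.pi / n))
        - Real.cos (k * ((m + m' : ℕ) * Real.pi / n))) / 2 := by
    intro k
    rw [Nat.cast_sub hle, Nat.cast_add,
      show (k : ℝ) * ((m - m') * Real.pi / n) = k * m / n * Real.pi - k * m' / n * Real.pi by ring,
      show (k : ℝ) * ((m + m') * Real.pi / n) = k * m / n * Real.pi + k * m' / n * Real.pi by ring,
      Real.cos_sub, Real.cos_add]
    ring
  simp only [hterm]
  rw [← Finset.sum_div, Finset.sum_sub_distrib,
    sum_cos_mul_pi_div (j := m + m') (by omega) (by omega)]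
  by_cases h : m = m'
  · subst h
    simp [← two_mul]
  · have hpar : (-1 : ℝ) ^ (m + m') = (-1) ^ (m - m') := by
      rw [show m + m' = m - m' + 2 * m' by omega, pow_add, pow_mul]
      simp
    rw [sum_cos_mul_pi_div (by omega) (by omega), if_neg h, hpar]
    ring

theorem psi_zero_right (m n : ℕ) : psi m n 0 = 0 := by simp [psi]

theorem psi_self_right (m n : ℕ) : psi m n n = 0 := by
  rcases Nat.eq_zero_or_pos n with rfl | hn
  · exact psi_zero_right m 0
  · rw [psi, mul_div_cancel_left₀ _ (Nat.cast_ne_zero.2 hn.ne'), Real.sin_nat_mul_pi, mul_zero]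

theorem psi_comm (m n k : ℕ) : psi m n k = psi k n m := by
  rw [psi, psi, mul_comm (k : ℝ)]

theorem sum_psi_mul_psi {n m m' : ℕ} (hm : 1 ≤ m) (hmn : m < n) (hm' : 1 ≤ m') (hmn' : m' < n) :
    ∑ k ∈ Finset.Icc 1 (n - 1), psi m n k * psi m' n k = if m = m' then 1 else 0 := by
  wlog hle : m' ≤ m generalizing m m'
  · simp only [mul_comm (psi m n _), this hm' hmn' hm hmn (by omega), eq_comm]
  have hn : (n : ℝ) ≠ 0 := Nat.cast_ne_zero.2 (by omega)
  have hsub : Finset.Icc 1 (n - 1) ⊆ Finset.range n := fun k hk => by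
    simp only [Finset.mem_Icc, Finset.mem_range] at *
    omega
  rw [Finset.sum_subset hsub fun k hk hk' => by
    have : k = 0 := by
      simp only [Finset.mem_Icc, Finset.mem_range] at *
      omega
    rw [this, psi_zero_right, zero_mul]]
  have hterm : ∀ k, psi m n k * psi m' n k
      = 2 / n * (Real.sin (k * m / n * Real.pi) * Real.sin (k * m' / n * Real.pi)) := by
    intro k
    rw [psi, psi, mul_mul_mul_comm, Real.mul_self_sqrt (by positivity)]
  simp only [hterm]
  rw [← Finset.mul_sum, sum_sin_mul_sin_of_le hm' hle hmn]
  split_ifs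
  · field_simp
  · simp

theorem psi_add_psi (m n k : ℕ) :
    psi m n k + psi m n (k + 2) = 2 * Real.cos ((m : ℝ) / n * Real.pi) * psi m n (k + 1) := by
  simp only [psi]
  rw [show (k : ℝ) * m / n * Real.pi
      = ((k + 1 : ℕ) : ℝ) * m / n * Real.pi - (m : ℝ) / n * Real.pi by push_cast; ring,
    show ((k + 2 : ℕ) : ℝ) * m / n * Real.pi
      = ((k + 1 : ℕ) : ℝ) * m / n * Real.pi + (m : ℝ) / n * Real.pi by push_cast; ring,
    Real.sin_sub, Real.sin_add]
  ring

/-- Summation by parts for the path with vertices `0, …, N + 1`. -/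
theorem sum_range_mul_neighbours (u F : ℕ → ℝ) (N : ℕ) :
    ∑ k ∈ Finset.range N, u (k + 1) * (F k + F (k + 2))
      = ∑ k ∈ Finset.range N, (u k + u (k + 2)) * F (k + 1)
        + (u N * F (N + 1) - u (N + 1) * F N + u 1 * F 0 - u 0 * F 1) := by
  induction N with
  | zero => simp
  | succ N ih =>
    rw [Finset.sum_range_succ, Finset.sum_range_succ, ih]
    ring

theorem sum_psi_mul_neighbours {n : ℕ} (hn : 1 ≤ n) (m : ℕ) (F : ℕ → ℝ) (h0 : F 0 = 0)
    (hFn : F n = 0) :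
    ∑ k ∈ Finset.Icc 1 (n - 1), psi m n k * (F (k - 1) + F (k + 1))
      = 2 * Real.cos ((m : ℝ) / n * Real.pi) * ∑ k ∈ Finset.Icc 1 (n - 1), psi m n k * F k := by
  obtain ⟨N, rfl⟩ := Nat.exists_eq_add_of_le' hn
  have hIcc : ∀ f : ℕ → ℝ, ∑ k ∈ Finset.Icc 1 (N + 1 - 1), f k
      = ∑ k ∈ Finset.range N, f (k + 1) := by
    intro f
    rw [Finset.range_eq_Ico, Finset.sum_Ico_add' f 0 N 1, Nat.add_sub_cancel, zero_add]
    rfl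
  have h := sum_range_mul_neighbours (psi m (N + 1)) F N
  rw [h0, hFn, psi_zero_right, psi_self_right] at h
  rw [hIcc, hIcc]
  simp only [Nat.add_sub_cancel, add_assoc, Nat.reduceAdd]
  rw [h, Finset.mul_sum]
  simp only [psi_add_psi]
  simp [mul_assoc]

end Psi

/-! ### The functions on a tetrahedron -/

section Tetrahedron

variable {q r : ℕ}

/-- If the product `F ⊗ G` is supported in the Diestel-Leader graph, its sum over the graph is the
product of the sums over the two trees. -/
theorem DL.hasSum_mul {F : HTree q → ℝ} {G : HTree r → ℝ} {A B : ℝ} (hF : HasSum F A)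
    (hG : HasSum G B) (h : ∀ x y, F x ≠ 0 → G y ≠ 0 → x.hor + y.hor = 0) :
    HasSum (fun x : DL q r => F x.1.1 * G x.1.2) (A * B) := by
  have hprod := hF.mul hG (summable_mul_of_summable_norm hF.summable.norm hG.summable.norm)
  refine (Function.Injective.hasSum_iff (g := Subtype.val)
    (f := fun p : HTree q × HTree r => F p.1 * G p.2) Subtype.val_injective fun p hp => ?_).2 hprod
  by_contra hne
  obtain ⟨h1, h2⟩ := ne_zero_and_ne_zero_of_mul hne
  exact hp ⟨⟨p, h _ _ h1 h2⟩, rfl⟩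

theorem Tetrahedron.ext_corners {S S' : Tetrahedron q r} (h₁ : S.a₁ = S'.a₁) (h₂ : S.a₂ = S'.a₂) :
    S = S' := by
  obtain ⟨a₁, a₂, n, h⟩ := S
  obtain ⟨a₁', a₂', n', h'⟩ := S'
  obtain rfl : a₁ = a₁' := h₁
  obtain rfl : a₂ = a₂' := h₂
  obtain rfl : n = n' := by omega
  rfl

/-- The neighbour of `x` reached by a step to a successor in the first tree. -/
def DL.succLeft (x : DL q r) (s : ZMod q) : DL q r :=
  ⟨(x.1.1.succ s, x.1.2.pred), by
    have := x.2
    simp only [HTree.hor_succ, HTree.hor_pred]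
    omega⟩

/-- The neighbour of `x` reached by a step to a successor in the second tree. -/
def DL.succRight (x : DL q r) (t : ZMod r) : DL q r :=
  ⟨(x.1.1.pred, x.1.2.succ t), by
    have := x.2
    simp only [HTree.hor_succ, HTree.hor_pred]
    omega⟩

theorem rho_eq (q r : ℕ) : rho q r = 2 * (√(q : ℝ) * √(r : ℝ)) / ((q : ℝ) + r) := by
  rw [rho, Real.sqrt_mul (Nat.cast_nonneg q)]

variable [NeZero q] [NeZero r]

/-- The restriction to `S.verts` is automatic, by the supports of the two factors. -/
theorem fFun_eq (S : Tetrahedron q r) (φ₁ : ZMod q → ℝ) (φ₂ : ZMod r → ℝ) (k : ℕ) (x : DL q r) :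
    fFun S φ₁ φ₂ k x = treeFun φ₁ S.a₁ k x.1.1 * treeFun φ₂ S.a₂ (S.height - k) x.1.2 := by
  rw [fFun]
  split_ifs with h
  · rfl
  · by_contra hne
    obtain ⟨h1, h2⟩ := ne_zero_and_ne_zero_of_mul (Ne.symm hne)
    exact h ⟨⟨_, iterate_pred_of_treeFun_ne_zero h1⟩, ⟨_, iterate_pred_of_treeFun_ne_zero h2⟩⟩

theorem finite_support_fFun (S : Tetrahedron q r) (φ₁ : ZMod q → ℝ) (φ₂ : ZMod r → ℝ) (k : ℕ) :
    (Function.support (fFun S φ₁ φ₂ k)).Finite := by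
  have hinj : Function.Injective fun x : DL q r => x.1 := Subtype.val_injective
  refine (((finite_support_treeFun φ₁ S.a₁ k).prod
    (finite_support_treeFun φ₂ S.a₂ (S.height - k))).preimage hinj.injOn).subset fun x hx => ?_
  rw [Function.mem_support, fFun_eq] at hx
  exact ne_zero_and_ne_zero_of_mul hx

theorem finite_support_gFun (S : Tetrahedron q r) (φ₁ : ZMod q → ℝ) (φ₂ : ZMod r → ℝ) (m : ℕ) :
    (Function.support (gFun S φ₁ φ₂ m)).Finite := by
  refine (Set.Finite.biUnion (Finset.Icc 1 (S.height - 1)).finite_toSet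
    fun k _ => finite_support_fFun S φ₁ φ₂ k).subset fun x hx => ?_
  obtain ⟨k, hk, hne⟩ := Finset.exists_ne_zero_of_sum_ne_zero hx
  exact Set.mem_biUnion (Finset.mem_coe.2 hk) (right_ne_zero_of_mul hne)

open Classical in
theorem hasSum_fFun_mul_fFun {S S' : Tetrahedron q r} {φ₁ φ₁' : ZMod q → ℝ} {φ₂ φ₂' : ZMod r → ℝ}
    (h₁ : ∑ s, φ₁ s = 0) (h₁' : ∑ s, φ₁' s = 0) (h₂ : ∑ s, φ₂ s = 0) (h₂' : ∑ s, φ₂' s = 0)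
    {k k' : ℕ} (hk : k ∈ Finset.Icc 1 (S.height - 1)) (hk' : k' ∈ Finset.Icc 1 (S'.height - 1)) :
    HasSum (fun x => fFun S φ₁ φ₂ k x * fFun S' φ₁' φ₂' k' x)
      (if S = S' ∧ k = k' then (∑ s, φ₁ s * φ₁' s) * ∑ s, φ₂ s * φ₂' s else 0) := by
  rw [Finset.mem_Icc] at hk hk'
  have h := DL.hasSum_mul
    (hasSum_treeFun_mul_treeFun h₁ h₁' S.a₁ S'.a₁ (k := k) (k' := k') (by omega) (by omega))
    (hasSum_treeFun_mul_treeFun h₂ h₂' S.a₂ S'.a₂ (k := S.height - k) (k' := S'.height - k')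
      (by omega) (by omega)) fun x y hx hy => by
    have hx' := hor_of_treeFun_ne_zero (left_ne_zero_of_mul hx)
    have hy' := hor_of_treeFun_ne_zero (left_ne_zero_of_mul hy)
    have := S.hor_eq
    omega
  have hiff : (S = S' ∧ k = k') ↔
      (S.a₁ = S'.a₁ ∧ k = k') ∧ (S.a₂ = S'.a₂ ∧ S.height - k = S'.height - k') := by
    constructor
    · rintro ⟨rfl, rfl⟩
      exact ⟨⟨rfl, rfl⟩, rfl, rfl⟩
    · rintro ⟨⟨h1, h2⟩, h3, -⟩
      exact ⟨Tetrahedron.ext_corners h1 h3, h2⟩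
  rw [ite_zero_mul_ite_zero] at h
  simp only [hiff, fFun_eq]
  convert h using 2 with x
  ring

theorem hasSum_gFun_mul_gFun {S S' : Tetrahedron q r} {i i' j j' m m' : ℕ}
    (hi : 1 ≤ i ∧ i < q) (hi' : 1 ≤ i' ∧ i' < q) (hj : 1 ≤ j ∧ j < r) (hj' : 1 ≤ j' ∧ j' < r)
    (hm : 1 ≤ m ∧ m < S.height) (hm' : 1 ≤ m' ∧ m' < S'.height) [Decidable
      (S = S' ∧ i = i' ∧ j = j' ∧ m = m')] :
    HasSum (fun x => gFun S (phi q i) (phi r j) m x * gFun S' (phi q i') (phi r j') m' x)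
      (if S = S' ∧ i = i' ∧ j = j' ∧ m = m' then 1 else 0) := by
  classical
  have h := hasSum_sum fun k (hk : k ∈ Finset.Icc 1 (S.height - 1)) =>
    hasSum_sum fun k' (hk' : k' ∈ Finset.Icc 1 (S'.height - 1)) =>
      (hasSum_fFun_mul_fFun (sum_phi hi.1 hi.2) (sum_phi hi'.1 hi'.2) (sum_phi hj.1 hj.2)
        (sum_phi hj'.1 hj'.2) hk hk').mul_left (psi m S.height k * psi m' S'.height k')
  convert h using 1
  · rfl
  · funext x
    rw [gFun, gFun, Finset.sum_mul_sum]
    refine Finset.sum_congr rfl fun k _ => Finset.sum_congr rfl fun k' _ => ?_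
    ring
  · rw [sum_phi_mul_phi hi.1 hi.2 hi'.1 hi'.2, sum_phi_mul_phi hj.1 hj.2 hj'.1 hj'.2]
    by_cases hS : S = S'
    · subst hS
      simp only [true_and]
      rw [Finset.sum_congr rfl (g := fun k => psi m S.height k * psi m' S.height k *
        ((if i = i' then 1 else 0) * if j = j' then 1 else 0)), ← Finset.sum_mul,
        sum_psi_mul_psi hm.1 hm.2 hm'.1 hm'.2, ite_zero_mul_ite_zero, ite_zero_mul_ite_zero]
      · simp only [mul_one]
        congr 1
        exact propext (by tauto)
      · intro k hk
        rw [Finset.sum_eq_single_of_mem k hk fun k' _ hne => by rw [if_neg hne.symm, mul_zero],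
          if_pos rfl]
    · simp [hS]

/-! ### The action of the transition operator -/

theorem DL.sum_neighborFinset (f : DL q r → ℂ) (x : DL q r) :
    ∑ y ∈ (DL.graph q r).neighborFinset x, f y
      = ∑ s : ZMod q, f (x.succLeft s) + ∑ t : ZMod r, f (x.succRight t) := by
  rw [← Finset.sum_coe_sort, ← Fintype.sum_equiv ((DL.nbrEquiv x).trans
    (Equiv.subtypeEquivRight fun y => by rw [SimpleGraph.mem_neighborFinset]; rfl))
    (fun p => f (DL.nbrEquiv x p).1) _ fun _ => rfl, Fintype.sum_sum_type]
  rfl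

/-- On the functions `F k` the random walk acts as `√(qr)/(q+r)` times the adjacency operator of the
path `1, …, n - 1`, which `psi` diagonalizes. -/
theorem srwFun_gFun {S : Tetrahedron q r} {φ₁ : ZMod q → ℝ} {φ₂ : ZMod r → ℝ} {m : ℕ}
    (h₁ : ∑ s, φ₁ s = 0) (h₂ : ∑ s, φ₂ s = 0) (hS : 1 ≤ S.height) (x : DL q r) :
    srwFun (DL.graph q r) (fun y => (gFun S φ₁ φ₂ m y : ℂ)) x
      = lam q r m S.height * gFun S φ₁ φ₂ m x := by
  let F : ℕ → ℝ := fun k => treeFun φ₁ S.a₁ k x.1.1 * treeFun φ₂ S.a₂ (S.height - k) x.1.2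
  have hF : ∀ k ∈ Finset.Icc 1 (S.height - 1),
      ∑ s, fFun S φ₁ φ₂ k (x.succLeft s) + ∑ t, fFun S φ₁ φ₂ k (x.succRight t)
      = √(q : ℝ) * √(r : ℝ) * (F (k - 1) + F (k + 1)) := by
    intro k hk
    rw [Finset.mem_Icc] at hk
    have hleft : ∀ s, fFun S φ₁ φ₂ k (x.succLeft s)
        = treeFun φ₁ S.a₁ k (x.1.1.succ s) * treeFun φ₂ S.a₂ (S.height - k) x.1.2.pred :=
      fun s => fFun_eq ..
    have hright : ∀ t, fFun S φ₁ φ₂ k (x.succRight t)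
        = treeFun φ₁ S.a₁ k x.1.1.pred * treeFun φ₂ S.a₂ (S.height - k) (x.1.2.succ t) :=
      fun t => fFun_eq ..
    simp only [hleft, hright]
    obtain ⟨k, rfl⟩ := Nat.exists_eq_add_of_le' hk.1
    -- Both depths are positive, so `treeFun_pred` applies on either side.
    obtain ⟨l, hl⟩ : ∃ l, S.height = k + 1 + (l + 1) := ⟨S.height - k - 2, by omega⟩
    simp only [F, hl]
    rw [show k + 1 + (l + 1) - (k + 1) = l + 1 by omega,
      show k + 1 + (l + 1) - (k + 1 - 1) = l + 1 + 1 by omega,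
      show k + 1 + (l + 1) - (k + 1 + 1) = l by omega, Nat.add_sub_cancel,
      ← Finset.sum_mul, ← Finset.mul_sum, sum_treeFun_succ h₁, sum_treeFun_succ h₂,
      treeFun_pred φ₁ _ (Nat.succ_ne_zero k), treeFun_pred φ₂ _ (Nat.succ_ne_zero l)]
    ring
  have hsum : ∑ s, gFun S φ₁ φ₂ m (x.succLeft s) + ∑ t, gFun S φ₁ φ₂ m (x.succRight t)
      = √(q : ℝ) * √(r : ℝ) * (2 * Real.cos ((m : ℝ) / S.height * Real.pi) * gFun S φ₁ φ₂ m x) := by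
    have hg : gFun S φ₁ φ₂ m x = ∑ k ∈ Finset.Icc 1 (S.height - 1), psi m S.height k * F k :=
      Finset.sum_congr rfl fun k _ => by rw [fFun_eq]
    rw [hg]
    simp only [gFun]
    rw [← sum_psi_mul_neighbours hS m F (by simp [F, treeFun_zero]) (by simp [F, treeFun_zero]),
      Finset.sum_comm, Finset.sum_comm (s := (Finset.univ : Finset (ZMod r))),
      ← Finset.sum_add_distrib, Finset.mul_sum]
    refine Finset.sum_congr rfl fun k hk => ?_
    rw [← Finset.mul_sum, ← Finset.mul_sum, ← mul_add, hF k hk]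
    ring
  rw [srwFun, DL.sum_neighborFinset, DL.regular q r x, lam, rho_eq]
  have hsum' := congrArg Complex.ofReal hsum
  push_cast at hsum' ⊢
  rw [hsum']
  ring

end Tetrahedron

/-! ### Real functions as vectors of the Hilbert space -/

section RealVec

variable {V : Type}

/-- A real function with finite support, as an element of the complex Hilbert space `ℓ²`. -/
noncomputable def realVec (f : V → ℝ) (hf : (Function.support f).Finite) : EllTwo V :=
  ⟨fun x => (f x : ℂ), by
    refine (memℓp_gen_iff (by norm_num)).2 (summable_of_hasFiniteSupport (hf.subset fun x hx => ?_))
    simp only [Function.mem_support] at hx ⊢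
    rintro h
    simp [h] at hx⟩

theorem EllTwo.inner_eq_of_hasSum {u v : EllTwo V} {f g : V → ℝ} (hu : ∀ x, u x = (f x : ℂ))
    (hv : ∀ x, v x = (g x : ℂ)) {A : ℝ} (h : HasSum (fun x => f x * g x) A) :
    inner ℂ u v = (A : ℂ) := by
  refine (lp.hasSum_inner u v).unique ?_
  convert Complex.hasSum_ofReal.2 h using 2 with x
  · rfl
  rw [hu, hv, RCLike.inner_apply, Complex.conj_ofReal, Complex.ofReal_mul, mul_comm]

theorem EllTwo.norm_sq_eq_of_hasSum {u : EllTwo V} {f : V → ℝ} (hu : ∀ x, u x = (f x : ℂ))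
    {A : ℝ} (h : HasSum (fun x => f x * f x) A) : ‖u‖ ^ 2 = A := by
  have h1 := inner_self_eq_norm_sq_to_K (𝕜 := ℂ) u
  rw [EllTwo.inner_eq_of_hasSum hu hu h] at h1
  exact (Complex.ofReal_injective (h1.trans (Complex.ofReal_pow _ _).symm)).symm

theorem EllTwo.exists_mem_span_of_mem_span {ι : Type*} {f : ι → V → ℝ} {v : ι → EllTwo V}
    (hv : ∀ i x, v i x = (f i x : ℂ)) {g : V → ℝ} (hg : g ∈ Submodule.span ℝ (Set.range f)) :
    ∃ w ∈ Submodule.span ℂ (Set.range v), ∀ x, w x = (g x : ℂ) := by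
  induction hg using Submodule.span_induction with
  | mem g hg =>
    obtain ⟨i, rfl⟩ := hg
    exact ⟨v i, Submodule.subset_span ⟨i, rfl⟩, hv i⟩
  | zero => exact ⟨0, Submodule.zero_mem _, fun x => by simp⟩
  | add g g' _ _ h h' =>
    obtain ⟨w, hw, hwg⟩ := h
    obtain ⟨w', hw', hwg'⟩ := h'
    exact ⟨w + w', Submodule.add_mem _ hw hw', fun x => by simp [hwg, hwg']⟩
  | smul c g _ h =>
    obtain ⟨w, hw, hwg⟩ := h
    exact ⟨(c : ℂ) • w, Submodule.smul_mem _ _ hw, fun x => by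
      rw [lp.coeFn_smul, Pi.smul_apply, hwg, Pi.smul_apply, smul_eq_mul, smul_eq_mul,
        Complex.ofReal_mul]⟩

end RealVec

/-! ### Completeness of the system -/

section Complete

variable {q r : ℕ}

open Classical in
theorem DL.single_eq_horoAvg_mul (x y : DL q r) :
    (lp.single 2 x (1 : ℂ) : EllTwo (DL q r)) y
      = ((horoAvg x.1.1 0 y.1.1 * horoAvg x.1.2 0 y.1.2 : ℝ) : ℂ) := by
  have h : y = x ↔ y.1.1 = x.1.1 ∧ y.1.2 = x.1.2 := by
    rw [← Prod.ext_iff]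
    exact Subtype.ext_iff
  rw [lp.single_apply, Pi.single_apply]
  simp only [horoAvg, Function.iterate_zero, id, pow_zero, inv_one, ite_zero_mul_ite_zero, ← h]
  split_ifs <;> simp

variable [NeZero q] [NeZero r]

theorem GIndex.finite_support_fn (t : GIndex q r) : (Function.support t.fn).Finite :=
  finite_support_gFun _ _ _ _

/-- The function `t.fn` as a vector of the Hilbert space. -/
noncomputable def GIndex.vec (t : GIndex q r) : EllTwo (DL q r) := realVec t.fn t.finite_support_fn

theorem GIndex.orthonormal_vec : Orthonormal ℂ (GIndex.vec : GIndex q r → EllTwo (DL q r)) := by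
  classical
  refine orthonormal_iff_ite.2 fun t t' => ?_
  have h := hasSum_gFun_mul_gFun ⟨t.one_le_i, t.i_lt⟩ ⟨t'.one_le_i, t'.i_lt⟩
    ⟨t.one_le_j, t.j_lt⟩ ⟨t'.one_le_j, t'.j_lt⟩ ⟨t.one_le_m, t.m_lt⟩ ⟨t'.one_le_m, t'.m_lt⟩
  rw [EllTwo.inner_eq_of_hasSum (f := t.fn) (g := t'.fn) (fun _ => rfl) (fun _ => rfl) h]
  have hiff : (t.S = t'.S ∧ t.i = t'.i ∧ t.j = t'.j ∧ t.m = t'.m) ↔ t = t' := by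
    constructor
    · obtain ⟨S, m, i, j, _⟩ := t
      obtain ⟨S', m', i', j', _⟩ := t'
      rintro ⟨h1, h2, h3, h4⟩
      obtain rfl : S = S' := h1
      obtain rfl : i = i' := h2
      obtain rfl : j = j' := h3
      obtain rfl : m = m' := h4
      rfl
    · rintro rfl
      exact ⟨rfl, rfl, rfl, rfl⟩
  simp only [hiff]
  split_ifs <;> simp

/-- The matrix `(psi m n k)` is symmetric and orthogonal, so the sine transform is inverted by
itself. -/
theorem fFun_eq_sum_gFun (S : Tetrahedron q r) (φ₁ : ZMod q → ℝ) (φ₂ : ZMod r → ℝ) {k : ℕ}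
    (hk : k ∈ Finset.Icc 1 (S.height - 1)) :
    fFun S φ₁ φ₂ k = ∑ m ∈ Finset.Icc 1 (S.height - 1), psi m S.height k • gFun S φ₁ φ₂ m := by
  have hIcc : ∀ l ∈ Finset.Icc 1 (S.height - 1), 1 ≤ l ∧ l < S.height := fun l hl => by
    rw [Finset.mem_Icc] at hl
    omega
  funext x
  simp only [Finset.sum_apply, Pi.smul_apply, smul_eq_mul, gFun, Finset.mul_sum]
  rw [Finset.sum_comm, Finset.sum_eq_single_of_mem k hk]
  · simp only [← mul_assoc]
    rw [← Finset.sum_mul]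
    simp only [fun m => psi_comm m S.height k]
    rw [sum_psi_mul_psi (hIcc k hk).1 (hIcc k hk).2 (hIcc k hk).1 (hIcc k hk).2, if_pos rfl,
      one_mul]
  · intro l hl hne
    simp only [← mul_assoc]
    rw [← Finset.sum_mul]
    simp only [psi_comm _ S.height k, psi_comm _ S.height l]
    rw [sum_psi_mul_psi (hIcc k hk).1 (hIcc k hk).2 (hIcc l hl).1 (hIcc l hl).2,
      if_neg hne.symm, zero_mul]

theorem fFun_phi_mem_span (S : Tetrahedron q r) {i j k : ℕ} (hi : 1 ≤ i ∧ i < q)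
    (hj : 1 ≤ j ∧ j < r) (hk : k ∈ Finset.Icc 1 (S.height - 1)) :
    fFun S (phi q i) (phi r j) k
      ∈ Submodule.span ℝ (Set.range (GIndex.fn : GIndex q r → DL q r → ℝ)) := by
  rw [fFun_eq_sum_gFun S _ _ hk]
  refine Submodule.sum_mem _ fun m hm => Submodule.smul_mem _ _ (Submodule.subset_span ?_)
  rw [Finset.mem_Icc] at hm
  exact ⟨⟨S, m, i, j, hm.1, by omega, hi.1, hi.2, hj.1, hj.2⟩, rfl⟩

/-- `f_k[S, φ₁, φ₂]` as a bilinear map of the functions `φ₁` and `φ₂`. -/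
noncomputable def fFunBilin (S : Tetrahedron q r) (k : ℕ) :
    (ZMod q → ℝ) →ₗ[ℝ] (ZMod r → ℝ) →ₗ[ℝ] (DL q r → ℝ) :=
  LinearMap.mk₂ ℝ (fun φ₁ φ₂ => fFun S φ₁ φ₂ k)
    (fun _ _ _ => by
      funext x
      simp only [Pi.add_apply, fFun_eq, treeFun_add]
      ring)
    (fun _ _ _ => by
      funext x
      simp only [Pi.smul_apply, smul_eq_mul, fFun_eq, treeFun_smul]
      ring)
    (fun _ _ _ => by
      funext x
      simp only [Pi.add_apply, fFun_eq, treeFun_add]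
      ring)
    (fun _ _ _ => by
      funext x
      simp only [Pi.smul_apply, smul_eq_mul, fFun_eq, treeFun_smul]
      ring)

omit [NeZero r] in
theorem centred_eq_sum_phi (t : ZMod q) :
    (fun s => (if s = t then 1 else 0) - (q : ℝ)⁻¹)
      = ∑ i ∈ Finset.univ.erase (0 : ZMod q), phi q i.val t • phi q i.val := by
  funext s
  rw [← sum_phi_mul_phi_dual s t, Finset.sum_apply]
  rfl

theorem fFun_centred_mem_span (S : Tetrahedron q r) (t₁ : ZMod q) (t₂ : ZMod r) {k : ℕ}
    (hk : k ∈ Finset.Icc 1 (S.height - 1)) :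
    fFun S (fun s => (if s = t₁ then 1 else 0) - (q : ℝ)⁻¹)
        (fun s => (if s = t₂ then 1 else 0) - (r : ℝ)⁻¹) k
      ∈ Submodule.span ℝ (Set.range (GIndex.fn : GIndex q r → DL q r → ℝ)) := by
  have hval : ∀ {n : ℕ} [NeZero n] {i : ZMod n}, i ∈ Finset.univ.erase (0 : ZMod n) →
      1 ≤ i.val ∧ i.val < n := fun {n} _ {i} hi =>
    ⟨Nat.one_le_iff_ne_zero.2 fun h => Finset.ne_of_mem_erase hi ((ZMod.val_eq_zero i).1 h),
      ZMod.val_lt i⟩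
  change fFunBilin S k _ _ ∈ _
  rw [centred_eq_sum_phi, centred_eq_sum_phi, map_sum]
  refine Submodule.sum_mem _ fun j hj => ?_
  rw [map_sum, LinearMap.sum_apply]
  refine Submodule.sum_mem _ fun i hi => ?_
  rw [map_smul, map_smul, LinearMap.smul_apply]
  exact Submodule.smul_mem _ _ (Submodule.smul_mem _ _ (fFun_phi_mem_span S (hval hi) (hval hj) hk))

theorem horoAvg_diff_mul_mem_span (x : DL q r) (k l : ℕ) :
    (fun y : DL q r => (horoAvg x.1.1 k y.1.1 - horoAvg x.1.1 (k + 1) y.1.1)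
        * (horoAvg x.1.2 l y.1.2 - horoAvg x.1.2 (l + 1) y.1.2))
      ∈ Submodule.span ℝ (Set.range (GIndex.fn : GIndex q r → DL q r → ℝ)) := by
  let S : Tetrahedron q r :=
    { a₁ := HTree.pred^[k + 1] x.1.1
      a₂ := HTree.pred^[l + 1] x.1.2
      height := k + 1 + (l + 1)
      hor_eq := by
        have := x.2
        rw [HTree.hor_iterate_pred, HTree.hor_iterate_pred]
        push_cast
        omega }
  convert Submodule.smul_mem _ ((√(q : ℝ))⁻¹ ^ k * (√(r : ℝ))⁻¹ ^ l) (fFun_centred_mem_span S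
    (x.1.1.label k) (x.1.2.label l) (k := k + 1) (Finset.mem_Icc.2 ⟨by omega, by simp [S]⟩)) using 1
  funext y
  rw [Pi.smul_apply, fFun_eq, horoAvg_sub_horoAvg_succ, horoAvg_sub_horoAvg_succ, smul_eq_mul,
    show S.height - (k + 1) = l + 1 from Nat.add_sub_cancel_left ..]
  simp only [S]
  ring

/-- Both factors telescope into sums of Haar type differences, so their product is a sum over pairs
of depths `(k + 1, l + 1)`, each of which belongs to one tetrahedron of height `k + l + 2`. -/
theorem horoAvg_telescope_mul_mem_span (x : DL q r) (K : ℕ) :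
    (fun y : DL q r => (horoAvg x.1.1 0 y.1.1 - horoAvg x.1.1 K y.1.1)
        * (horoAvg x.1.2 0 y.1.2 - horoAvg x.1.2 K y.1.2))
      ∈ Submodule.span ℝ (Set.range (GIndex.fn : GIndex q r → DL q r → ℝ)) := by
  convert Submodule.sum_mem _ fun k (_ : k ∈ Finset.range K) => Submodule.sum_mem _
    fun l (_ : l ∈ Finset.range K) => horoAvg_diff_mul_mem_span x k l using 1
  funext y
  simp only [Finset.sum_apply]
  rw [← Finset.sum_range_sub' (fun k => horoAvg x.1.1 k y.1.1),
    ← Finset.sum_range_sub' (fun k => horoAvg x.1.2 k y.1.2), Finset.sum_mul_sum]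

/-- The function of `horoAvg_telescope_mul_mem_span` has squared distance
`1 - (1 - q⁻ᴷ)(1 - r⁻ᴷ)` from the point mass at `x`. -/
theorem hasSum_telescope_sub_single_sq (x : DL q r) (K : ℕ) :
    HasSum (fun y : DL q r =>
        ((horoAvg x.1.1 0 y.1.1 - horoAvg x.1.1 K y.1.1)
            * (horoAvg x.1.2 0 y.1.2 - horoAvg x.1.2 K y.1.2)
          - horoAvg x.1.1 0 y.1.1 * horoAvg x.1.2 0 y.1.2)
        * ((horoAvg x.1.1 0 y.1.1 - horoAvg x.1.1 K y.1.1)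
            * (horoAvg x.1.2 0 y.1.2 - horoAvg x.1.2 K y.1.2)
          - horoAvg x.1.1 0 y.1.1 * horoAvg x.1.2 0 y.1.2))
      (1 - (1 - ((q : ℝ) ^ K)⁻¹) * (1 - ((r : ℝ) ^ K)⁻¹)) := by
  have hlevel : ∀ {n : ℕ} {z w : HTree n}, horoAvg z 0 w ≠ 0 ∨ horoAvg z K w ≠ 0 →
      w.hor = z.hor := fun h => h.elim hor_of_horoAvg_ne_zero hor_of_horoAvg_ne_zero
  have hdiff : ∀ {n : ℕ} {z w : HTree n}, horoAvg z 0 w - horoAvg z K w ≠ 0 →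
      w.hor = z.hor := fun {n z w} h => hlevel <| by
    by_contra hne
    push Not at hne
    exact h (by rw [hne.1, hne.2, sub_zero])
  have h00 : ∀ {n : ℕ} [NeZero n] (z : HTree n),
      HasSum (fun w => horoAvg z 0 w * horoAvg z 0 w) 1 := fun {n} _ z => by
    simpa using hasSum_horoAvg_mul_horoAvg z (le_refl 0)
  have h0 : ∀ {n : ℕ} [NeZero n] (z : HTree n),
      HasSum (fun w => (horoAvg z 0 w - horoAvg z K w) * horoAvg z 0 w)
        (1 - ((n : ℝ) ^ K)⁻¹) := fun {n} _ z => by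
    convert (h00 z).sub (hasSum_horoAvg_mul_horoAvg z (Nat.zero_le K)) using 2 with w
    · rfl
    · ring
  have hK : ∀ {n : ℕ} [NeZero n] (z : HTree n),
      HasSum (fun w => (horoAvg z 0 w - horoAvg z K w) * (horoAvg z 0 w - horoAvg z K w))
        (1 - ((n : ℝ) ^ K)⁻¹) := fun {n} _ z => by
    convert ((h0 z).sub (hasSum_horoAvg_mul_horoAvg z (Nat.zero_le K))).add
      (hasSum_horoAvg_mul_horoAvg z (le_refl K)) using 2 with w
    · rfl
    · ring
    · ring
  have hx := x.2
  have hA := DL.hasSum_mul (hK x.1.1) (hK x.1.2) fun y z hy hz => by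
    rw [hdiff (left_ne_zero_of_mul hy), hdiff (left_ne_zero_of_mul hz), hx]
  have hB := DL.hasSum_mul (h0 x.1.1) (h0 x.1.2) fun y z hy hz => by
    rw [hdiff (left_ne_zero_of_mul hy), hdiff (left_ne_zero_of_mul hz), hx]
  have hC := DL.hasSum_mul (h00 x.1.1) (h00 x.1.2) fun y z hy hz => by
    rw [hlevel (.inl (left_ne_zero_of_mul hy)), hlevel (.inl (left_ne_zero_of_mul hz)), hx]
  convert (hA.sub (hB.mul_left 2)).add hC using 2 with y
  · rfl
  · ring
  · ring

open Classical Filter Topology in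
theorem DL.single_mem_closure_span (hq : 2 ≤ q) (hr : 2 ≤ r) (x : DL q r) :
    (lp.single 2 x (1 : ℂ) : EllTwo (DL q r))
      ∈ (Submodule.span ℂ (Set.range (GIndex.vec : GIndex q r → _))).topologicalClosure := by
  choose w hw hwx using fun K => EllTwo.exists_mem_span_of_mem_span
    (f := (GIndex.fn : GIndex q r → DL q r → ℝ)) (v := GIndex.vec) (fun _ _ => rfl)
    (horoAvg_telescope_mul_mem_span x K)
  have hnorm : ∀ K, ‖w K - lp.single 2 x (1 : ℂ)‖ ^ 2
      = 1 - (1 - ((q : ℝ) ^ K)⁻¹) * (1 - ((r : ℝ) ^ K)⁻¹) := fun K =>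
    EllTwo.norm_sq_eq_of_hasSum (fun y => by
      rw [lp.coeFn_sub, Pi.sub_apply, hwx, DL.single_eq_horoAvg_mul, ← Complex.ofReal_sub])
      (hasSum_telescope_sub_single_sq x K)
  have hpow : ∀ {n : ℕ}, 2 ≤ n → Tendsto (fun K : ℕ => ((n : ℝ) ^ K)⁻¹) atTop (𝓝 0) :=
    fun {n} hn => (tendsto_pow_atTop_atTop_of_one_lt
      (by exact_mod_cast hn : (1 : ℝ) < n)).inv_tendsto_atTop
  have hlim : Tendsto (fun K => ‖w K - lp.single 2 x (1 : ℂ)‖ ^ 2) atTop (𝓝 0) := by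
    simp only [hnorm]
    simpa using tendsto_const_nhds.sub (((hpow hq).const_sub 1).mul ((hpow hr).const_sub 1))
      (f := fun _ => (1 : ℝ)) (a := 1)
  refine mem_closure_of_tendsto (b := atTop) (tendsto_iff_norm_sub_tendsto_zero.2 ?_) (Eventually.of_forall hw)
  simpa using hlim.sqrt

theorem GIndex.top_le_closure_span (hq : 2 ≤ q) (hr : 2 ≤ r) :
    ⊤ ≤ (Submodule.span ℂ (Set.range (GIndex.vec : GIndex q r → _))).topologicalClosure := by
  classical
  intro f _
  refine (Submodule.isClosed_topologicalClosure _).mem_of_tendsto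
    (lp.hasSum_single (by norm_num) f) (Filter.Eventually.of_forall fun s => ?_)
  refine Submodule.sum_mem _ fun x _ => ?_
  have h : lp.single 2 x (f x) = f x • (lp.single 2 x (1 : ℂ) : EllTwo (DL q r)) := by
    rw [← lp.single_smul, smul_eq_mul, mul_one]
  rw [h]
  exact Submodule.smul_mem _ _ (DL.single_mem_closure_span hq hr x)

theorem DL.P_vec (t : GIndex q r) :
    DL.P q r t.vec = (lam q r t.m t.S.height : ℂ) • t.vec := by
  ext x
  exact srwFun_gFun (sum_phi t.one_le_i t.i_lt) (sum_phi t.one_le_j t.j_lt)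
    (t.one_le_m.trans t.m_lt.le) x

end Complete

/-! ### Operators that are diagonal in a Hilbert basis -/

section Diagonal

open Module.End

variable {ι E : Type*} [NormedAddCommGroup E] [InnerProductSpace ℂ E]
  {b : HilbertBasis ι ℂ E} {T : E →L[ℂ] E} {l : ι → ℂ}

namespace HilbertBasis

theorem repr_apply_of_diagonal (hT : ∀ i, T (b i) = l i • b i) (u : E) (i : ι) :
    b.repr (T u) i = l i * b.repr u i := by
  simp only [b.repr_apply_apply]
  have h : (innerSL ℂ (b i)).comp T = l i • innerSL ℂ (b i) := by
    refine ContinuousLinearMap.ext_on (s := Set.range b) ?_ ?_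
    · exact Submodule.dense_iff_topologicalClosure_eq_top.2 b.dense_span
    · rintro _ ⟨j, rfl⟩
      simp only [ContinuousLinearMap.comp_apply, hT, map_smul, smul_apply,
        innerSL_apply_apply, smul_eq_mul]
      by_cases hij : i = j
      · rw [hij]
      · rw [b.orthonormal.2 hij, mul_zero, mul_zero]
  exact congrArg (fun A => A u) h

theorem hasEigenvector_of_diagonal (hT : ∀ i, T (b i) = l i • b i) (i : ι) :
    HasEigenvector (T : Module.End ℂ E) (l i) (b i) :=
  ⟨mem_eigenspace_iff.2 (hT i), b.orthonormal.ne_zero i⟩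

theorem setOf_hasEigenvalue_of_diagonal (hT : ∀ i, T (b i) = l i • b i) :
    {μ : ℂ | HasEigenvalue (T : Module.End ℂ E) μ} = Set.range l := by
  ext μ
  constructor
  · intro h
    obtain ⟨u, hu⟩ := h.exists_hasEigenvector
    by_contra hμ
    refine hu.2 (b.repr.map_eq_zero_iff.1 (lp.ext (funext fun i => ?_)))
    have h1 := repr_apply_of_diagonal hT u i
    rw [show T u = μ • u from hu.apply_eq_smul, map_smul, lp.coeFn_smul, Pi.smul_apply,
      smul_eq_mul] at h1
    have h2 : (μ - l i) * b.repr u i = 0 := by rw [sub_mul, h1, sub_self]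
    exact (mul_eq_zero.1 h2).resolve_left (sub_ne_zero.2 fun h => hμ ⟨i, h.symm⟩)
  · rintro ⟨i, rfl⟩
    exact hasEigenvalue_of_hasEigenvector (hasEigenvector_of_diagonal hT i)

theorem iSup_eigenspace_of_diagonal (hT : ∀ i, T (b i) = l i • b i) :
    (⨆ μ : ℂ, eigenspace (T : Module.End ℂ E) μ).topologicalClosure = ⊤ := by
  rw [eq_top_iff, ← b.dense_span]
  refine Submodule.topologicalClosure_mono (Submodule.span_le.2 ?_)
  rintro _ ⟨i, rfl⟩
  exact Submodule.mem_iSup_of_mem (l i) (hasEigenvector_of_diagonal hT i).1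

/-- Away from the closure of the diagonal entries `μ - T` is bounded below, and its range contains
all basis vectors, so it is invertible; the diagonal entries themselves are eigenvalues. -/
theorem spectrum_of_diagonal [CompleteSpace E] (hT : ∀ i, T (b i) = l i • b i) :
    spectrum ℂ T = closure (Set.range l) := by
  refine Set.Subset.antisymm (fun μ hμ => ?_) (closure_minimal ?_ (spectrum.isClosed T))
  · by_contra hcl
    rw [Metric.mem_closure_iff] at hcl
    push Not at hcl
    obtain ⟨ε, hε, hdist⟩ := hcl
    replace hdist : ∀ i, ε ≤ ‖μ - l i‖ := fun i => by
      rw [← dist_eq_norm]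
      exact hdist _ ⟨i, rfl⟩
    have happly : ∀ u, (algebraMap ℂ (E →L[ℂ] E) μ - T) u = μ • u - T u := fun u => by
      rw [sub_apply, ContinuousLinearMap.algebraMap_apply]
    have hrepr : ∀ u i, b.repr ((algebraMap ℂ (E →L[ℂ] E) μ - T) u) i
        = (μ - l i) * b.repr u i := fun u i => by
      rw [happly, map_sub, map_smul, lp.coeFn_sub, Pi.sub_apply, repr_apply_of_diagonal hT,
        lp.coeFn_smul, Pi.smul_apply, smul_eq_mul, sub_mul]
    refine hμ (spectrum.mem_resolventSet_iff.2 ?_)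
    rw [ContinuousLinearMap.isUnit_iff_bijective,
      ContinuousLinearMap.bijective_iff_dense_range_and_antilipschitz]
    constructor
    · rw [eq_top_iff, ← b.dense_span]
      refine Submodule.topologicalClosure_mono (Submodule.span_le.2 ?_)
      rintro _ ⟨i, rfl⟩
      have hne : μ - l i ≠ 0 := norm_pos_iff.1 (hε.trans_le (hdist i))
      refine ⟨(μ - l i)⁻¹ • b i, ?_⟩
      change (algebraMap ℂ (E →L[ℂ] E) μ - T) _ = _
      rw [map_smul, happly, hT, ← sub_smul, smul_smul, inv_mul_cancel₀ hne, one_smul]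
    · refine ⟨ε⁻¹.toNNReal, ContinuousLinearMap.antilipschitz_of_bound _ fun u => ?_⟩
      rw [Real.coe_toNNReal _ (inv_nonneg.2 hε.le), inv_mul_eq_div, le_div_iff₀ hε, ← b.repr.norm_map u,
        ← b.repr.norm_map ((algebraMap ℂ (E →L[ℂ] E) μ - T) u)]
      refine le_of_sq_le_sq ?_ (norm_nonneg _)
      rw [mul_pow]
      have h1 := (lp.hasSum_norm (p := 2) (by norm_num) (b.repr u)).mul_right (ε ^ 2)
      have h2 := lp.hasSum_norm (p := 2) (by norm_num)
        (b.repr ((algebraMap ℂ (E →L[ℂ] E) μ - T) u))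
      simp only [ENNReal.toReal_ofNat, Real.rpow_ofNat] at h1 h2
      refine hasSum_le (fun i => ?_) h1 h2
      rw [hrepr, norm_mul, mul_pow, mul_comm]
      gcongr
      exact hdist i
  · rintro _ ⟨i, rfl⟩
    intro hunit
    have h := (ContinuousLinearMap.isUnit_iff_bijective.1 hunit).1
    refine b.orthonormal.ne_zero i (h ?_)
    rw [map_zero, sub_apply, ContinuousLinearMap.algebraMap_apply, hT, sub_self]

end HilbertBasis

end Diagonal

/-! ### The set of eigenvalues -/

section LamSet

theorem rho_pos {q r : ℕ} (hq : 0 < q) (hr : 0 < r) : 0 < rho q r := by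
  have hq' : (0 : ℝ) < q := Nat.cast_pos.2 hq
  have hr' : (0 : ℝ) < r := Nat.cast_pos.2 hr
  rw [rho]
  positivity

/-- The fractions `m/n` with `1 ≤ m ≤ n - 1` are the rational numbers in `(0, 1)`. -/
theorem lamSet_eq_image (q r : ℕ) :
    lamSet q r = (fun x : ℝ => rho q r * Real.cos (x * Real.pi)) ''
      (Set.Ioo 0 1 ∩ Set.range ((↑) : ℚ → ℝ)) := by
  ext l
  constructor
  · rintro ⟨n, m, hn, hm, hmn, rfl⟩
    have hn' : (0 : ℝ) < n := Nat.cast_pos.2 (by omega)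
    refine ⟨(m : ℝ) / n, ⟨⟨div_pos (Nat.cast_pos.2 hm) hn', ?_⟩, (m : ℚ) / n, by push_cast; rfl⟩,
      rfl⟩
    rw [div_lt_one hn']
    exact_mod_cast (by omega : m < n)
  · rintro ⟨_, ⟨⟨h0, h1⟩, x, rfl⟩, rfl⟩
    have h0' : 0 < x := by exact_mod_cast h0
    have h1' : x < 1 := by exact_mod_cast h1
    have hnum : 0 < x.num := Rat.num_pos.2 h0'
    have hlt : x.num < x.den := Rat.num_lt_denom_iff.2 h1'
    refine ⟨x.den, x.num.toNat, by omega, by omega, by omega, ?_⟩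
    rw [lam]
    congr 3
    have hcast : ((x.num.toNat : ℕ) : ℝ) = ((x.num : ℤ) : ℝ) := by
      exact_mod_cast Int.toNat_of_nonneg hnum.le
    rw [hcast]
    exact Rat.cast_def x

theorem closure_lamSet {q r : ℕ} (hq : 0 < q) (hr : 0 < r) :
    closure (lamSet q r) = Set.Icc (-rho q r) (rho q r) := by
  have hρ := rho_pos hq hr
  have hcont : Continuous fun x : ℝ => rho q r * Real.cos (x * Real.pi) := by fun_prop
  refine Set.Subset.antisymm (closure_minimal ?_ isClosed_Icc) fun y hy => ?_
  · rintro _ ⟨n, m, -, -, -, rfl⟩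
    have h1 := Real.neg_one_le_cos ((m : ℝ) / n * Real.pi)
    have h2 := Real.cos_le_one ((m : ℝ) / n * Real.pi)
    exact ⟨by rw [lam]; nlinarith, by rw [lam]; nlinarith⟩
  · rw [lamSet_eq_image]
    refine image_closure_subset_closure_image hcont ?_
    have hdense : Set.Icc 0 1 ⊆ closure (Set.Ioo (0 : ℝ) 1 ∩ Set.range ((↑) : ℚ → ℝ)) := by
      rw [← closure_Ioo zero_ne_one]
      exact closure_minimal (Rat.denseRange_cast.open_subset_closure_inter isOpen_Ioo)
        isClosed_closure
    refine Set.image_mono hdense ⟨Real.arccos (y / rho q r) / Real.pi,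
      ⟨div_nonneg (Real.arccos_nonneg _) Real.pi_pos.le,
        (div_le_one Real.pi_pos).2 (Real.arccos_le_pi _)⟩, ?_⟩
    simp only
    rw [div_mul_cancel₀ _ Real.pi_ne_zero, Real.cos_arccos, mul_div_cancel₀ _ hρ.ne']
    · rw [le_div_iff₀ hρ]
      linarith [hy.1]
    · rw [div_le_one hρ]
      exact hy.2

theorem range_lam_GIndex {q r : ℕ} (hq : 2 ≤ q) (hr : 2 ≤ r) :
    Set.range (fun t : GIndex q r => (lam q r t.m t.S.height : ℂ))
      = Complex.ofReal '' lamSet q r := by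
  ext μ
  constructor
  · rintro ⟨t, rfl⟩
    have h1 := t.one_le_m
    have h2 := t.m_lt
    exact ⟨_, ⟨t.S.height, t.m, by omega, by omega, by omega, rfl⟩, rfl⟩
  · rintro ⟨_, ⟨n, m, hn, hm, hmn, rfl⟩, rfl⟩
    let S : Tetrahedron q r := ⟨HTree.root q, ⟨fun _ => 0, ⟨0, fun _ _ => rfl⟩, -n⟩, n, by
      simp [HTree.root]⟩
    -- `i = j = 1` is admissible since `q, r ≥ 2`.
    exact ⟨⟨S, m, 1, 1, hm, by simp only [S]; omega, le_rfl, hq, le_rfl, hr⟩, rfl⟩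

end LamSet

theorem theorem3p7 (q r : ℕ) [NeZero q] [NeZero r] (hq : 2 ≤ q) (hr : 2 ≤ r) :
    -- the spectrum is the interval `[-ρ, ρ]`, and `ρ` is the spectral radius
    spectrum ℂ (DL.P q r) = Complex.ofReal '' Set.Icc (-rho q r) (rho q r) ∧
    spectralRadius ℂ (DL.P q r) = ENNReal.ofReal (rho q r) ∧
    -- it is the closure of the set of the `λ_{m,n}`, which are precisely the eigenvalues
    spectrum ℂ (DL.P q r) = closure (Complex.ofReal '' lamSet q r) ∧
    {μ : ℂ | Module.End.HasEigenvalue (DL.P q r : Module.End ℂ (EllTwo (DL q r))) μ}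
      = Complex.ofReal '' lamSet q r ∧
    -- it is pure point: the eigenvectors span a dense subspace
    (⨆ μ : ℂ, Module.End.eigenspace
      (DL.P q r : Module.End ℂ (EllTwo (DL q r))) μ).topologicalClosure = ⊤ ∧
    -- the `g_m^{[S,i,j]}` are finitely supported
    (∀ t : GIndex q r, (Function.support t.fn).Finite) ∧
    -- and form a complete orthonormal system of eigenfunctions
    ∃ b : HilbertBasis (GIndex q r) ℂ (EllTwo (DL q r)),
      (∀ t x, b t x = (t.fn x : ℂ)) ∧
      ∀ t, DL.P q r (b t) = (lam q r t.m t.S.height : ℂ) • b t := by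
  let b := HilbertBasis.mk GIndex.orthonormal_vec (GIndex.top_le_closure_span hq hr)
  have hb : ∀ t, b t = t.vec := fun t => congrFun (HilbertBasis.coe_mk _ _) t
  have hP : ∀ t, DL.P q r (b t) = (lam q r t.m t.S.height : ℂ) • b t := fun t => by
    rw [hb, DL.P_vec]
  have hρ := rho_pos (NeZero.pos q) (NeZero.pos r)
  have hcl : spectrum ℂ (DL.P q r) = closure (Complex.ofReal '' lamSet q r) := by
    rw [HilbertBasis.spectrum_of_diagonal hP, range_lam_GIndex hq hr]
  have hIcc : spectrum ℂ (DL.P q r) = Complex.ofReal '' Set.Icc (-rho q r) (rho q r) := by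
    rw [hcl, Complex.isometry_ofReal.isClosedEmbedding.closure_image_eq,
      closure_lamSet (NeZero.pos q) (NeZero.pos r)]
  refine ⟨hIcc, ?_, hcl, ?_, HilbertBasis.iSup_eigenspace_of_diagonal hP,
    GIndex.finite_support_fn, b, fun t x => by rw [hb]; rfl, hP⟩
  · rw [spectralRadius, hIcc]
    refine le_antisymm (iSup₂_le ?_) ?_
    · rintro _ ⟨x, hx, rfl⟩
      change ‖(x : ℂ)‖ₑ ≤ _
      rw [← ofReal_norm, Complex.norm_real]
      exact ENNReal.ofReal_le_ofReal (abs_le.2 hx)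
    · refine le_iSup₂_of_le (rho q r : ℂ) ⟨_, ⟨by linarith, le_rfl⟩, rfl⟩ ?_
      change _ ≤ ‖(rho q r : ℂ)‖ₑ
      rw [← ofReal_norm, Complex.norm_real, Real.norm_of_nonneg hρ.le]
  · rw [HilbertBasis.setOf_hasEigenvalue_of_diagonal hP, range_lam_GIndex hq hr]
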